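/- Let $\Phi:\mathbb R^d\times\mathbb R\to\mathbb R^d$ be a continuous vector field $\Phi(x,t)$ that is differentiable in $x$ with jointly continuous derivative $D\Phi(x,t)$. Fix $T\ge 0$ and $x\in\mathbb R^d$, and assume that for all initial points $y$ near $x$ the solution $S_t(y)$ of $\frac{d}{dt}S_t(y)=\Phi(S_t(y),t)$, $S_0(y)=y$, exists on $[0,T]$. Let $L(x,t)=DS_t(x)$ be the tangent map. Let $\xi$ be a $d$-dimensional white noise on $[0,T]$, $\langle\xi(t')\rangle=0$ and $\langle\xi(t')\xi^T(t'')\rangle=I\,\delta(t'-t'')$. That is, let $w(t)=\int_0^t\xi(t')\,dt'$ be a square integrable process in $\mathbb R^d$ with almost surely continuous paths, $w(0)=0$ almost surely, $\langle w(t)\rangle=0$ and $\langle w(s)w^T(t)\rangle=I\min(s,t)$ for $s,t\in[0,T]$ (for example, a standard Wiener process). The noisy evolution $y_\epsilon$ is given by the solutions of $$y_\epsilon(t)=x+\int_0^t\Phi(y_\epsilon(s),s)\,ds+\epsilon\,w(t),\qquad 0\le t\le T,$$ understood path by path: almost surely, $y_\epsilon$ is a continuous solution on $[0,T]$ for all sufficiently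 small $\epsilon\ne0$. The linear response of the forward evolution is $\Xi_F(x,t)=\lim_{\epsilon\to0}\bigl(y_\epsilon(t)-S_t(x)\bigr)/\epsilon$ (almost surely, for all $t\in[0,T]$). Then, for all $t\in[0,T]$, $S_t$ is differentiable at $x$, the matrix $L(x,t)$ is invertible, and the entries of $(L^T(x,t')L(x,t'))^{-1}$ are integrable in $t'$ on $[0,t]$. A noisy evolution exists, and for every noisy evolution the following hold. 1. The linear response exists. A process is the linear response if and only if it is almost surely a continuous solution on $[0,T]$ of the linear equation $\frac{d}{dt}\Xi_F(x,t)=D\Phi(S_t(x),t)\,\Xi_F(x,t)+\xi(t)$, $\Xi_F(x,0)=0$, that is, of $\Xi_F(x,t)=\int_0^tD\Phi(S_s(x),s)\,\Xi_F(x,s)\,ds+w(t)$. 2. Almost surely, for all $t\in[0,T]$, $$\Xi_F(x,t)=L(x,t)\int_0^tL^{-1}(x,t')\,\xi(t')\,dt',$$ where $\int_0^tL^{-1}(x,t')\,\xi(t')\,dt'=\int_0^tL^{-1}(x,t')\,dw(t')$ is the limit of the Riemann–Stieltjes sums as the mesh of the subdivision tends to $0$, both pathwise almost surely and in mean square. 3.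 For each $t\in[0,T]$, $\Xi_F(x,t)$ is square integrable with mean zero, and its covariance matrix is $$\Sigma_F^2(x,t)=L(x,t)\,\int_0^t\bigl(L^T(x,t')L(x,t')\bigr)^{-1}dt'\;L^T(x,t).$$ 4. The forward error, defined as the square root of the trace of the covariance matrix of $\Xi_F(x,t)$, equals $$\sqrt{\operatorname{Tr}\Bigl(L(x,t)\int_0^t\bigl(L^T(x,t')L(x,t')\bigr)^{-1}dt'\;L^T(x,t)\Bigr)}.$$ -/

import Mathlib

open MeasureTheory ProbabilityTheory Filter Topology Set
open scoped Matrix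

noncomputable section

namespace ForwardNoise

/-- The space `ℝ^d` with its Euclidean norm. -/
abbrev Space (d : ℕ) : Type := EuclideanSpace ℝ (Fin d)

/-! ### Vector field, flow and tangent map -/

/-- The spatial derivative `DΦ(y, t)` of a time dependent vector field. -/
def spatialDeriv {d : ℕ} (Φ : Space d → ℝ → Space d) (y : Space d) (t : ℝ) :
    Space d →L[ℝ] Space d :=
  fderiv ℝ (fun z => Φ z t) y

/-- `Φ(y, t)` is continuous, and it is differentiable in `y` with a derivative `DΦ(y, t)` that is
continuous in `(y, t)`. -/
structure IsC1VectorField {d : ℕ} (Φ : Space d → ℝ → Space d) : Prop where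
  continuous : Continuous (fun p : Space d × ℝ => Φ p.1 p.2)
  differentiable : ∀ t, Differentiable ℝ (fun y => Φ y t)
  continuous_deriv : Continuous (fun p : Space d × ℝ => spatialDeriv Φ p.1 p.2)

/-- `γ` solves `γ' = Φ(γ, t)` on `[0, T]` with `γ(0) = y`. -/
def IsSolution {d : ℕ} (Φ : Space d → ℝ → Space d) (T : ℝ) (y : Space d) (γ : ℝ → Space d) :
    Prop :=
  γ 0 = y ∧ ∀ t ∈ Icc 0 T, HasDerivWithinAt γ (Φ (γ t) t) (Icc 0 T) t

/-- `S_t(y) = S t y` is the forward evolution of the initial conditions `y` near `x`, for times in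
`[0, T]`. -/
def IsForwardFlowNear {d : ℕ} (Φ : Space d → ℝ → Space d) (T : ℝ) (x : Space d)
    (S : ℝ → Space d → Space d) : Prop :=
  ∀ᶠ y in 𝓝 x, IsSolution Φ T y (fun t => S t y)

/-- The tangent map `L(x, t) = D S_t(x)`, with entries `L_ij = ∂ (S_t(x))_i / ∂ x_j`. -/
def tangentMap {d : ℕ} (S : ℝ → Space d → Space d) (x : Space d) (t : ℝ) :
    Matrix (Fin d) (Fin d) ℝ :=
  Matrix.of fun i j => (fderiv ℝ (S t) x (EuclideanSpace.single j 1)) i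

/-! ### White noise and integrals against it -/

/-- `w` is the integral `w(t) = ∫_0^t ξ(t') dt'` on `[0, T]` of a white noise `ξ` in `ℝ^d`:
it has continuous paths, and the relations `⟨ξ(t')⟩ = 0` and `⟨ξ(t') ξᵀ(t'')⟩ = I δ(t' - t'')`
hold in integrated form, `⟨w(s)⟩ = 0` and `⟨w(s) wᵀ(t)⟩ = I min(s, t)`.
The standard Wiener process is an example. -/
structure IsIntegratedWhiteNoise {d : ℕ} {Ω : Type*} [MeasurableSpace Ω] (P : Measure Ω) (T : ℝ)
    (w : ℝ → Ω → Space d) : Prop where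
  memLp : ∀ t ∈ Icc 0 T, MemLp (w t) 2 P
  zero : ∀ᵐ ω ∂P, w 0 ω = 0
  continuousOn : ∀ᵐ ω ∂P, ContinuousOn (fun t => w t ω) (Icc 0 T)
  mean : ∀ t ∈ Icc 0 T, ∫ ω, w t ω ∂P = 0
  correlation : ∀ s ∈ Icc 0 T, ∀ t ∈ Icc 0 T, ∀ i j,
    ∫ ω, w s ω i * w t ω j ∂P = if i = j then min s t else 0

/-- A subdivision `a = p_0 ≤ p_1 ≤ ⋯ ≤ p_n = b` with tags `τ_k ∈ [p_k, p_{k+1}]`. -/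
structure Subdivision (a b : ℝ) where
  n : ℕ
  p : ℕ → ℝ
  τ : ℕ → ℝ
  left : p 0 = a
  right : p n = b
  tag_mem : ∀ k < n, τ k ∈ Icc (p k) (p (k + 1))

/-- All intervals of the subdivision are shorter than `δ`. -/
def Subdivision.FinerThan {a b : ℝ} (π : Subdivision a b) (δ : ℝ) : Prop :=
  ∀ k < π.n, π.p (k + 1) - π.p k < δ

/-- The sum `∑_k F(τ_k) (g(p_{k+1}) - g(p_k))`. -/
def stieltjesSum {d : ℕ} {a b : ℝ} (F : ℝ → Matrix (Fin d) (Fin d) ℝ) (g : ℝ → Space d)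
    (π : Subdivision a b) : Space d :=
  ∑ k ∈ Finset.range π.n, (F (π.τ k)).toEuclideanLin (g (π.p (k + 1)) - g (π.p k))

/-- `J` is the Riemann-Stieltjes integral `∫_a^b F(t') dg(t')`. -/
def HasStieltjesIntegral {d : ℕ} (F : ℝ → Matrix (Fin d) (Fin d) ℝ) (g : ℝ → Space d) (a b : ℝ)
    (J : Space d) : Prop :=
  ∀ ε > 0, ∃ δ > 0, ∀ π : Subdivision a b, π.FinerThan δ → ‖stieltjesSum F g π - J‖ < ε

/-- The random vector `J` is the Wiener integral `∫_a^b F(t') dw(t')` of the deterministic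
matrix function `F`: the limit in mean square of the sums `∑_k F(τ_k) (w(p_{k+1}) - w(p_k))`. -/
def IsWienerIntegral {d : ℕ} {Ω : Type*} [MeasurableSpace Ω] (P : Measure Ω)
    (F : ℝ → Matrix (Fin d) (Fin d) ℝ) (w : ℝ → Ω → Space d) (a b : ℝ) (J : Ω → Space d) : Prop :=
  MemLp J 2 P ∧ ∀ ε > 0, ∃ δ > 0, ∀ π : Subdivision a b, π.FinerThan δ →
    eLpNorm (fun ω => stieltjesSum F (fun t => w t ω) π - J ω) 2 P < ENNReal.ofReal ε

/-! ### Noisy evolution and linear response -/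

/-- The path `γ` solves `dγ = Φ(γ, t) dt + ε dg` on `[0, T]` with `γ(0) = x`. The noise is additive,
so that the equation makes sense for a single path `g` of the integrated noise. -/
def IsNoisySolution {d : ℕ} (Φ : Space d → ℝ → Space d) (T : ℝ) (x : Space d) (g : ℝ → Space d)
    (ε : ℝ) (γ : ℝ → Space d) : Prop :=
  ContinuousOn γ (Icc 0 T) ∧
    ∀ t ∈ Icc 0 T, γ t = x + (∫ s in (0 : ℝ)..t, Φ (γ s) s) + ε • g t

/-- `y ε t ω` is the noisy evolution of `x` on `[0, T]` at noise amplitude `ε`. A noisy path may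
explode before the time `T` unless `ε` is small; only small `ε` matter for the limit `ε → 0`. -/
def IsNoisyEvolution {d : ℕ} {Ω : Type*} [MeasurableSpace Ω] (P : Measure Ω)
    (Φ : Space d → ℝ → Space d) (T : ℝ) (x : Space d) (w : ℝ → Ω → Space d)
    (y : ℝ → ℝ → Ω → Space d) : Prop :=
  ∀ᵐ ω ∂P, ∀ᶠ ε in 𝓝[≠] (0 : ℝ),
    IsNoisySolution Φ T x (fun t => w t ω) ε (fun t => y ε t ω)

/-- The linear response `Ξ(t) = lim_{ε → 0} (y_ε(t) - S_t(x)) / ε`, for all `t` in `[0, T]`. -/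
def IsLinearResponse {d : ℕ} {Ω : Type*} [MeasurableSpace Ω] (P : Measure Ω)
    (S : ℝ → Space d → Space d) (T : ℝ) (x : Space d) (y : ℝ → ℝ → Ω → Space d)
    (Ξ : ℝ → Ω → Space d) : Prop :=
  ∀ᵐ ω ∂P, ∀ t ∈ Icc 0 T,
    Tendsto (fun ε : ℝ => ε⁻¹ • (y ε t ω - S t x)) (𝓝[≠] 0) (𝓝 (Ξ t ω))

/-- The linear equation `dΞ = DΦ(S_t(x), t) Ξ dt + dw` on `[0, T]` with `Ξ(0) = 0`. -/
def SolvesLinearEquation {d : ℕ} {Ω : Type*} [MeasurableSpace Ω] (P : Measure Ω)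
    (Φ : Space d → ℝ → Space d) (S : ℝ → Space d → Space d) (T : ℝ) (x : Space d)
    (w : ℝ → Ω → Space d) (Ξ : ℝ → Ω → Space d) : Prop :=
  ∀ᵐ ω ∂P, ContinuousOn (fun t => Ξ t ω) (Icc 0 T) ∧
    ∀ t ∈ Icc 0 T, Ξ t ω = (∫ s in (0 : ℝ)..t, spatialDeriv Φ (S s x) s (Ξ s ω)) + w t ω

/-! ### Covariance matrix and forward error -/

/-- The covariance matrix of a random vector. -/
def covarianceMatrix {d : ℕ} {Ω : Type*} [MeasurableSpace Ω] (P : Measure Ω) (X : Ω → Space d) :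
    Matrix (Fin d) (Fin d) ℝ :=
  Matrix.of fun i j => cov[fun ω => X ω i, fun ω => X ω j; P]

/-- The forward error: the square root of the trace of the covariance matrix. -/
def forwardError {d : ℕ} {Ω : Type*} [MeasurableSpace Ω] (P : Measure Ω) (X : Ω → Space d) : ℝ :=
  Real.sqrt (covarianceMatrix P X).trace

/-- The entrywise integral `∫_a^b M(s) ds` of a matrix function. -/
def matrixIntegral {d : ℕ} (M : ℝ → Matrix (Fin d) (Fin d) ℝ) (a b : ℝ) :
    Matrix (Fin d) (Fin d) ℝ :=
  Matrix.of fun i j => ∫ s in a..b, M s i j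

/-- The matrix `L(x, t) (∫_0^t (Lᵀ(x, t') L(x, t'))⁻¹ dt') Lᵀ(x, t)`. -/
def forwardMatrix {d : ℕ} (L : ℝ → Matrix (Fin d) (Fin d) ℝ) (t : ℝ) :
    Matrix (Fin d) (Fin d) ℝ :=
  L t * matrixIntegral (fun s => ((L s)ᵀ * L s)⁻¹) 0 t * (L t)ᵀ

end ForwardNoise

end

open ForwardNoise

/-!
The idea is to work pathwise in the Banach space `C([0, T], ℝ^d)`. An evolution with additive
perturbation `p` is a solution `γ` of `defect γ = p`, where `defect γ = γ - ∫_0^t Φ(γ(s), s) ds`.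
Initial conditions `y` correspond to constant perturbations `p = y`, and noise of amplitude `ε` to
`p = x + ε w`; both are covered by one application of the inverse function theorem.

* `defect` is strictly differentiable (`hasStrictFDerivAt_defect`), and its derivative
  `u ↦ u - ∫_0^t DΦ(S_s(x), s) u(s) ds` is invertible, because the Neumann series of a Volterra
  operator converges (`isUnit_one_sub_volterra`). Hence `defect` has a differentiable local inverse
  at the reference path. By Grönwall's inequality `defect` is injective (`defect_injective`), so
  that the local inverse yields every flow `S_t(y)` with `y` near `x` and every noisy evolution with
  small `ε`.
* The derivative of the local inverse in the direction of constant paths is the tangent map `L`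
  (`hasFDerivAt_flow`), and in the direction of `w` it is the linear response
  (`tendsto_of_eventually_isNoisySolution`). In both cases it is the solution operator of the
  linearized integral equation (`eq_response_iff`).
* The solution `M` of `M' = -M DΦ(S_t(x), t)`, `M(0) = 1`, is a left inverse of `L`, and variation
  of constants in the form of partial integration gives `M Ξ = M w - ∫_0^t M'(s) w(s) ds`
  (`inverseTangent_apply_volterraEquiv_symm`).
* The right-hand side is the Riemann-Stieltjes integral `∫_0^t M dw`, because `M` is continuously
  differentiable (`tendsto_stieltjes`). This statement holds for integrators with values in a Banach
  space, and it applies to the paths of `w` as well as to `w` as a curve in `L²`, which is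
  continuous since `E |w_j(s) - w_j(t)|² = |s - t|`. The two limits agree almost surely
  (`coeFn_integralByParts_noiseCurve`).
* In `L²` the relation `E w_i(s) w_j(t) = δ_ij min(s, t)` makes the integral an isometry
  (`inner_integralByParts_integralByParts`), so that `∫_0^t M dw` has covariance matrix
  `∫_0^t M Mᵀ = ∫_0^t (Lᵀ L)⁻¹`.
-/

noncomputable section

namespace ForwardNoise

/-! ### Volterra equations -/

section Volterra

variable {E : Type*} [NormedAddCommGroup E] [NormedSpace ℝ E] {T : ℝ}

/-- The primitive `t ↦ ∫_0^t u(s) ds` of a continuous path `u` on `[0, T]`, as a bounded operator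
on paths. Outside `[0, T]` the path is extended by its end values. -/
def primitive (hT : 0 ≤ T) : C(Icc (0 : ℝ) T, E) →L[ℝ] C(Icc (0 : ℝ) T, E) :=
  LinearMap.mkContinuous
    { toFun := fun u => ⟨fun t => ∫ s in (0 : ℝ)..t, IccExtend hT u s, by
        have : Continuous fun t : ℝ => ∫ s in (0 : ℝ)..t, IccExtend hT u s :=
          intervalIntegral.continuous_primitive
            (fun a b => (u.continuous.Icc_extend' (h := hT)).intervalIntegrable a b) 0
        exact this.comp continuous_subtype_val⟩
      map_add' := fun u v => by
        ext t
        exact intervalIntegral.integral_add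
          ((u.continuous.Icc_extend' (h := hT)).intervalIntegrable _ _)
          ((v.continuous.Icc_extend' (h := hT)).intervalIntegrable _ _)
      map_smul' := fun c u => by
        ext t
        exact intervalIntegral.integral_smul c _ }
    T (fun u => by
      rw [ContinuousMap.norm_le _ (by positivity)]
      intro t
      refine (intervalIntegral.norm_integral_le_of_norm_le_const (C := ‖u‖)
        fun s _ => u.norm_coe_le_norm _).trans ?_
      rw [sub_zero, abs_of_nonneg t.2.1, mul_comm]
      gcongr
      exact t.2.2)

theorem primitive_apply (hT : 0 ≤ T) (u : C(Icc (0 : ℝ) T, E)) (t : Icc (0 : ℝ) T) :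
    primitive hT u t = ∫ s in (0 : ℝ)..t, IccExtend hT u s := rfl

/-- The operator `(A u)(t) = A(t) u(t)` on continuous paths. -/
def mulOp (A : C(Icc (0 : ℝ) T, E →L[ℝ] E)) : C(Icc (0 : ℝ) T, E) →L[ℝ] C(Icc (0 : ℝ) T, E) :=
  LinearMap.mkContinuous
    { toFun := fun u => ⟨fun t => A t (u t), A.continuous.clm_apply u.continuous⟩
      map_add' := fun u v => by ext t; simp
      map_smul' := fun c u => by ext t; simp }
    ‖A‖ (fun u => by
      rw [ContinuousMap.norm_le _ (by positivity)]
      exact fun t => ((A t).le_opNorm _).trans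
        (mul_le_mul (A.norm_coe_le_norm t) (u.norm_coe_le_norm t) (norm_nonneg _)
          (norm_nonneg A)))

@[simp] theorem mulOp_apply (A : C(Icc (0 : ℝ) T, E →L[ℝ] E)) (u : C(Icc (0 : ℝ) T, E))
    (t : Icc (0 : ℝ) T) : mulOp A u t = A t (u t) := rfl

/-- The Volterra operator `u ↦ ∫_0^t A(s) u(s) ds`. -/
def volterra (hT : 0 ≤ T) (A : C(Icc (0 : ℝ) T, E →L[ℝ] E)) :
    C(Icc (0 : ℝ) T, E) →L[ℝ] C(Icc (0 : ℝ) T, E) :=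
  primitive hT ∘L mulOp A

theorem norm_volterra_pow_apply_le (hT : 0 ≤ T) (A : C(Icc (0 : ℝ) T, E →L[ℝ] E))
    (u : C(Icc (0 : ℝ) T, E)) (n : ℕ) (t : Icc (0 : ℝ) T) :
    ‖(volterra hT A ^ n) u t‖ ≤ (‖A‖ * t) ^ n / n.factorial * ‖u‖ := by
  induction n generalizing t with
  | zero => simpa using u.norm_coe_le_norm t
  | succ n ih =>
    rw [pow_succ']
    change ‖∫ s in (0 : ℝ)..t, IccExtend hT (mulOp A ((volterra hT A ^ n) u)) s‖ ≤ _
    have hbound : ∀ s ∈ Ioc (0 : ℝ) t,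
        ‖IccExtend hT (mulOp A ((volterra hT A ^ n) u)) s‖ ≤
          ‖A‖ * ((‖A‖ * s) ^ n / n.factorial * ‖u‖) := by
      intro s hs
      have hs' : s ∈ Icc 0 T := ⟨hs.1.le, hs.2.trans t.2.2⟩
      rw [IccExtend_of_mem _ _ hs', mulOp_apply]
      exact ((A _).le_opNorm _).trans
        (mul_le_mul (A.norm_coe_le_norm _) (ih _) (norm_nonneg _) (norm_nonneg A))
    refine (intervalIntegral.norm_integral_le_of_norm_le t.2.1
      (ae_of_all _ hbound) (Continuous.intervalIntegrable (by fun_prop) _ _)).trans_eq ?_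
    have : ∀ s : ℝ, ‖A‖ * ((‖A‖ * s) ^ n / n.factorial * ‖u‖) =
        (‖A‖ ^ (n + 1) / n.factorial * ‖u‖) * s ^ n := fun s => by ring
    simp_rw [this, intervalIntegral.integral_const_mul, integral_pow, Nat.factorial_succ]
    push_cast
    have := Nat.factorial_ne_zero n
    field_simp
    ring

/-- Neumann series. -/
theorem isUnit_one_sub_of_norm_pow_le {F : Type*} [NormedAddCommGroup F] [NormedSpace ℝ F]
    [CompleteSpace F] (V : F →L[ℝ] F) {b : ℕ → ℝ} (hb : Summable b) (hV : ∀ n, ‖V ^ n‖ ≤ b n) :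
    IsUnit (1 - V) := by
  have hs : Summable fun n => V ^ n := hb.of_norm_bounded hV
  exact ⟨⟨_, _, hs.one_sub_mul_tsum_pow, hs.tsum_pow_mul_one_sub⟩, rfl⟩

theorem isUnit_one_sub_volterra [CompleteSpace E] (hT : 0 ≤ T)
    (A : C(Icc (0 : ℝ) T, E →L[ℝ] E)) : IsUnit (1 - volterra hT A) := by
  refine isUnit_one_sub_of_norm_pow_le (volterra hT A)
    (Real.summable_pow_div_factorial (‖A‖ * T)) fun n => ?_
  refine ContinuousLinearMap.opNorm_le_bound _ (by positivity) fun u => ?_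
  rw [ContinuousMap.norm_le _ (by positivity)]
  intro t
  refine (norm_volterra_pow_apply_le hT A u n t).trans ?_
  have := t.2.1
  have := t.2.2
  gcongr

/-- The operator `1 - V` of a Volterra equation `u = p + V u`, as an isomorphism. -/
def volterraEquiv [CompleteSpace E] (hT : 0 ≤ T) (A : C(Icc (0 : ℝ) T, E →L[ℝ] E)) :
    C(Icc (0 : ℝ) T, E) ≃L[ℝ] C(Icc (0 : ℝ) T, E) :=
  ContinuousLinearEquiv.ofUnit (isUnit_one_sub_volterra hT A).unit

theorem coe_volterraEquiv [CompleteSpace E] (hT : 0 ≤ T) (A : C(Icc (0 : ℝ) T, E →L[ℝ] E)) :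
    (volterraEquiv hT A : C(Icc (0 : ℝ) T, E) →L[ℝ] C(Icc (0 : ℝ) T, E)) =
      1 - volterra hT A := rfl

theorem volterraEquiv_apply [CompleteSpace E] (hT : 0 ≤ T) (A : C(Icc (0 : ℝ) T, E →L[ℝ] E))
    (u : C(Icc (0 : ℝ) T, E)) (t : Icc (0 : ℝ) T) :
    volterraEquiv hT A u t =
      u t - ∫ s in (0 : ℝ)..t, IccExtend hT A s (IccExtend hT u s) := rfl

theorem volterraEquiv_symm_apply [CompleteSpace E] (hT : 0 ≤ T)
    (A : C(Icc (0 : ℝ) T, E →L[ℝ] E)) (p : C(Icc (0 : ℝ) T, E)) (t : Icc (0 : ℝ) T) :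
    (volterraEquiv hT A).symm p t =
      p t + ∫ s in (0 : ℝ)..t,
        IccExtend hT A s (IccExtend hT ((volterraEquiv hT A).symm p) s) := by
  have h := volterraEquiv_apply hT A ((volterraEquiv hT A).symm p) t
  rw [ContinuousLinearEquiv.apply_symm_apply] at h
  rw [h, sub_add_cancel]

end Volterra

/-! ### The integral equation of the evolution -/

section Evolution

variable {d : ℕ} {Φ : Space d → ℝ → Space d} {T : ℝ}

/-- The path `t ↦ Φ(γ(t), t)`. -/
def velocity (hΦ : IsC1VectorField Φ) (γ : C(Icc (0 : ℝ) T, Space d)) :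
    C(Icc (0 : ℝ) T, Space d) :=
  ⟨fun t => Φ (γ t) t, hΦ.continuous.comp (γ.continuous.prodMk continuous_subtype_val)⟩

/-- The path `t ↦ DΦ(γ(t), t)`. -/
def derivAlong (hΦ : IsC1VectorField Φ) (γ : C(Icc (0 : ℝ) T, Space d)) :
    C(Icc (0 : ℝ) T, Space d →L[ℝ] Space d) :=
  ⟨fun t => spatialDeriv Φ (γ t) t,
    hΦ.continuous_deriv.comp (γ.continuous.prodMk continuous_subtype_val)⟩

theorem continuous_derivAlong (hΦ : IsC1VectorField Φ) :
    Continuous (derivAlong (T := T) hΦ) := by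
  refine ContinuousMap.continuous_of_continuous_uncurry _ ?_
  exact hΦ.continuous_deriv.comp
    (continuous_eval.prodMk (continuous_subtype_val.comp continuous_snd))

/-- The mean value inequality applies at each time: the points of the segment between `γ₁(t)` and
`γ₂(t)` lie on paths of the segment between `γ₁` and `γ₂`, along which `DΦ` is uniformly close to
`DΦ` along `φ`. -/
theorem hasStrictFDerivAt_velocity (hΦ : IsC1VectorField Φ) (φ : C(Icc (0 : ℝ) T, Space d)) :
    HasStrictFDerivAt (velocity hΦ) (mulOp (derivAlong hΦ φ)) φ := by
  refine .of_isLittleO ?_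
  rw [Asymptotics.isLittleO_iff]
  intro c hc
  have hcont : ContinuousAt (derivAlong (T := T) hΦ) φ := (continuous_derivAlong hΦ).continuousAt
  have hnhds : Metric.ball (derivAlong hΦ φ) c ∈ 𝓝 (derivAlong hΦ φ) :=
    Metric.ball_mem_nhds (derivAlong hΦ φ) hc
  obtain ⟨δ, hδ, hball⟩ := Metric.mem_nhds_iff.1 (hcont hnhds)
  have hmem : Metric.ball φ δ ×ˢ Metric.ball φ δ ∈ 𝓝 (φ, φ) :=
    prod_mem_nhds (Metric.ball_mem_nhds _ hδ) (Metric.ball_mem_nhds _ hδ)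
  filter_upwards [hmem] with q hq
  rw [ContinuousMap.norm_le _ (by positivity)]
  intro t
  have hseg := convex_segment (𝕜 := ℝ) (q.2 t) (q.1 t)
  have hmv := hseg.norm_image_sub_le_of_norm_hasFDerivWithin_le'
    (f := fun z => Φ z t) (f' := fun z => spatialDeriv Φ z t) (φ := spatialDeriv Φ (φ t) t) (C := c)
    (fun z _ => (hΦ.differentiable t z).hasFDerivAt.hasFDerivWithinAt) ?_
    (left_mem_segment ℝ _ _) (right_mem_segment ℝ _ _)
  · refine hmv.trans ?_
    gcongr
    exact (q.1 - q.2).norm_coe_le_norm t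
  · rintro z ⟨a, b, ha, hb, hab, rfl⟩
    have hconv : a • q.2 + b • q.1 ∈ Metric.ball φ δ :=
      convex_ball φ δ hq.2 hq.1 ha hb hab
    have := (ContinuousMap.dist_lt_iff hc).1 (Metric.mem_ball.1 (hball hconv)) t
    rw [dist_eq_norm] at this
    exact this.le

/-- The evolution with perturbation `p` solves `defect γ = p`, where
`defect γ = γ - ∫_0^t Φ(γ(s), s) ds`. -/
def defect (hΦ : IsC1VectorField Φ) (hT : 0 ≤ T) (γ : C(Icc (0 : ℝ) T, Space d)) :
    C(Icc (0 : ℝ) T, Space d) :=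
  γ - primitive hT (velocity hΦ γ)

theorem hasStrictFDerivAt_defect (hΦ : IsC1VectorField Φ) (hT : 0 ≤ T)
    (φ : C(Icc (0 : ℝ) T, Space d)) :
    HasStrictFDerivAt (defect hΦ hT)
      (volterraEquiv hT (derivAlong hΦ φ) :
        C(Icc (0 : ℝ) T, Space d) →L[ℝ] C(Icc (0 : ℝ) T, Space d)) φ := by
  rw [coe_volterraEquiv]
  exact (hasStrictFDerivAt_id φ).sub
    ((primitive hT).hasStrictFDerivAt.comp φ (hasStrictFDerivAt_velocity hΦ φ))

theorem defect_apply_eq_iff (hΦ : IsC1VectorField Φ) (hT : 0 ≤ T)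
    {γ p : C(Icc (0 : ℝ) T, Space d)} {γ' : ℝ → Space d} (h : ∀ t : Icc (0 : ℝ) T, γ' t = γ t) :
    defect hΦ hT γ = p ↔ ∀ t : Icc (0 : ℝ) T, γ' t = p t + ∫ s in (0 : ℝ)..t, Φ (γ' s) s := by
  rw [ContinuousMap.ext_iff]
  refine forall_congr' fun t => ?_
  have : primitive hT (velocity hΦ γ) t = ∫ s in (0 : ℝ)..t, Φ (γ' s) s := by
    rw [primitive_apply]
    refine intervalIntegral.integral_congr fun s hs => ?_
    rw [uIcc_of_le t.2.1] at hs
    have hs' : s ∈ Icc 0 T := ⟨hs.1, hs.2.trans t.2.2⟩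
    change IccExtend hT (velocity hΦ γ) s = _
    rw [IccExtend_of_mem _ _ hs', h ⟨s, hs'⟩]
    rfl
  rw [h t, ← this, ← sub_eq_iff_eq_add]
  rfl

/-- Uniqueness, by Grönwall's inequality on a ball that contains both paths, where `Φ` is
Lipschitz. -/
theorem defect_injective (hΦ : IsC1VectorField Φ) (hT : 0 ≤ T) :
    Function.Injective (defect hΦ hT) := by
  intro γ₁ γ₂ h
  set R := max ‖γ₁‖ ‖γ₂‖
  obtain ⟨K, hK⟩ : ∃ K, ∀ q ∈ Metric.closedBall (0 : Space d) R ×ˢ Icc 0 T,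
      ‖spatialDeriv Φ q.1 q.2‖ ≤ K :=
    ((isCompact_closedBall _ _).prod isCompact_Icc).exists_bound_of_continuousOn
      hΦ.continuous_deriv.continuousOn
  set u := velocity hΦ γ₁ - velocity hΦ γ₂
  have hdiff : γ₁ - γ₂ = primitive hT u := by
    rw [map_sub, sub_eq_sub_iff_sub_eq_sub]
    exact h
  have hu : Continuous (IccExtend hT u) := u.continuous.Icc_extend'
  have hder : ∀ t, HasDerivAt (fun t => ∫ s in (0 : ℝ)..t, IccExtend hT u s)
      (IccExtend hT u t) t := fun t => hu.integral_hasStrictDerivAt 0 t |>.hasDerivAt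
  have hgr : ∀ t ∈ Icc 0 T, ‖∫ s in (0 : ℝ)..t, IccExtend hT u s‖ ≤
      gronwallBound 0 K 0 (t - 0) := by
    refine norm_le_gronwallBound_of_norm_deriv_right_le
      (fun t _ => (hder t).continuousAt.continuousWithinAt)
      (fun t _ => (hder t).hasDerivWithinAt) (by simp) fun t ht => ?_
    have ht' : t ∈ Icc 0 T := Ico_subset_Icc_self ht
    have hd : ∫ s in (0 : ℝ)..t, IccExtend hT u s = γ₁ ⟨t, ht'⟩ - γ₂ ⟨t, ht'⟩ :=
      (DFunLike.congr_fun hdiff ⟨t, ht'⟩).symm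
    rw [hd, IccExtend_of_mem _ _ ht', add_zero]
    refine (convex_closedBall (0 : Space d) R).norm_image_sub_le_of_norm_hasFDerivWithin_le
      (f := fun z => Φ z t) (f' := fun z => spatialDeriv Φ z t)
      (fun z _ => (hΦ.differentiable t z).hasFDerivAt.hasFDerivWithinAt)
      (fun z hz => hK (z, t) ⟨hz, ht'⟩) ?_ ?_
    · exact mem_closedBall_zero_iff.2 ((γ₂.norm_coe_le_norm _).trans (le_max_right _ _))
    · exact mem_closedBall_zero_iff.2 ((γ₁.norm_coe_le_norm _).trans (le_max_left _ _))
  ext1 t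
  have := hgr t t.2
  rw [gronwallBound_ε0_δ0, norm_le_zero_iff] at this
  rw [← sub_eq_zero, ← ContinuousMap.sub_apply, hdiff]
  exact this

/-- The evolution as a function of the perturbation `p`, near the reference path `φ`: the local
inverse of `defect`, given by the inverse function theorem. Only its values at `p` near `defect φ`
are meaningful. -/
def evolution (hΦ : IsC1VectorField Φ) (hT : 0 ≤ T) (φ : C(Icc (0 : ℝ) T, Space d)) :
    C(Icc (0 : ℝ) T, Space d) → C(Icc (0 : ℝ) T, Space d) :=
  (hasStrictFDerivAt_defect hΦ hT φ).localInverse _ _ _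

theorem eventually_defect_evolution (hΦ : IsC1VectorField Φ) (hT : 0 ≤ T)
    (φ : C(Icc (0 : ℝ) T, Space d)) :
    ∀ᶠ p in 𝓝 (defect hΦ hT φ), defect hΦ hT (evolution hΦ hT φ p) = p :=
  (hasStrictFDerivAt_defect hΦ hT φ).eventually_right_inverse

theorem evolution_defect (hΦ : IsC1VectorField Φ) (hT : 0 ≤ T)
    (φ : C(Icc (0 : ℝ) T, Space d)) : evolution hΦ hT φ (defect hΦ hT φ) = φ :=
  (hasStrictFDerivAt_defect hΦ hT φ).localInverse_apply_image

theorem hasFDerivAt_evolution (hΦ : IsC1VectorField Φ) (hT : 0 ≤ T)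
    (φ : C(Icc (0 : ℝ) T, Space d)) :
    HasFDerivAt (evolution hΦ hT φ)
      ((volterraEquiv hT (derivAlong hΦ φ)).symm :
        C(Icc (0 : ℝ) T, Space d) →L[ℝ] C(Icc (0 : ℝ) T, Space d)) (defect hΦ hT φ) :=
  (hasStrictFDerivAt_defect hΦ hT φ).to_localInverse.hasFDerivAt

end Evolution

/-! ### Riemann-Stieltjes integrals by partial integration -/

section Stieltjes

variable {E : Type*} [NormedAddCommGroup E] [NormedSpace ℝ E]

/-- The filter of subdivisions whose mesh tends to `0`. -/
def fineMesh (a b : ℝ) : Filter (Subdivision a b) :=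
  ⨅ δ ∈ Ioi (0 : ℝ), 𝓟 {π | π.FinerThan δ}

theorem hasBasis_fineMesh (a b : ℝ) :
    (fineMesh a b).HasBasis (fun δ : ℝ => 0 < δ) fun δ => {π | π.FinerThan δ} := by
  refine hasBasis_biInf_principal ?_ ⟨1, mem_Ioi.2 one_pos⟩
  intro δ₁ h₁ δ₂ h₂
  exact ⟨min δ₁ δ₂, mem_Ioi.2 (lt_min h₁ h₂), fun π hπ k hk => (hπ k hk).trans_le (min_le_left _ _),
    fun π hπ k hk => (hπ k hk).trans_le (min_le_right _ _)⟩

theorem hasStieltjesIntegral_iff_tendsto {d : ℕ} {F : ℝ → Matrix (Fin d) (Fin d) ℝ}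
    {g : ℝ → Space d} {a b : ℝ} {J : Space d} :
    HasStieltjesIntegral F g a b J ↔ Tendsto (stieltjesSum F g) (fineMesh a b) (𝓝 J) := by
  rw [(hasBasis_fineMesh a b).tendsto_iff Metric.nhds_basis_ball]
  simp only [HasStieltjesIntegral, Metric.mem_ball, dist_eq_norm, mem_ofPred_eq, gt_iff_lt]

/-- The value `f(t) g(t) - f(0) g(0) - ∫_0^t f'(s) g(s) ds` that partial integration assigns to
`∫_0^t f dg`. -/
def integralByParts (f f' : ℝ → ℝ) (g : ℝ → E) (t : ℝ) : E :=
  f t • g t - f 0 • g 0 - ∫ s in (0 : ℝ)..t, f' s • g s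

theorem Subdivision.monotoneOn {a b : ℝ} (π : Subdivision a b) : MonotoneOn π.p (Iic π.n) := by
  refine monotoneOn_of_le_succ ordConnected_Iic fun k _ _ hk => ?_
  have := π.tag_mem k (Nat.lt_of_succ_le hk)
  exact this.1.trans this.2

theorem Subdivision.p_mem {a b : ℝ} (π : Subdivision a b) {k : ℕ} (hk : k ≤ π.n) :
    π.p k ∈ Icc a b := by
  have h0 := π.monotoneOn (show 0 ∈ Iic π.n from Nat.zero_le _) hk (Nat.zero_le k)
  have h1 := π.monotoneOn hk (show π.n ∈ Iic π.n from self_mem_Iic) hk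
  rw [π.left] at h0
  rw [π.right] at h1
  exact ⟨h0, h1⟩

theorem Subdivision.τ_mem {a b : ℝ} (π : Subdivision a b) {k : ℕ} (hk : k < π.n) :
    π.τ k ∈ Icc a b :=
  ⟨(π.p_mem hk.le).1.trans (π.tag_mem k hk).1, (π.tag_mem k hk).2.trans (π.p_mem hk).2⟩

/-- On one interval of a subdivision the error of the Riemann-Stieltjes sum equals
`∫_a^τ f' (g - g(a)) + ∫_τ^b f' (g - g(b))`. -/
theorem norm_stieltjes_term_sub_le [CompleteSpace E] {f f' : ℝ → ℝ} {g : ℝ → E} {a τ b C η : ℝ}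
    (haτ : a ≤ τ) (hτb : τ ≤ b) (hf : ∀ s, HasDerivAt f (f' s) s) (hf' : Continuous f')
    (hg : ContinuousOn g (Icc a b)) (hC : ∀ s ∈ Icc a b, |f' s| ≤ C)
    (hga : ∀ s ∈ Icc a b, ‖g s - g a‖ ≤ η) (hgb : ∀ s ∈ Icc a b, ‖g s - g b‖ ≤ η) :
    ‖f τ • (g b - g a) - (f b • g b - f a • g a - ∫ s in a..b, f' s • g s)‖ ≤
      C * η * (b - a) := by
  have key : ∀ c e : ℝ, a ≤ c → c ≤ e → e ≤ b → ∀ v : E,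
      (∫ s in c..e, f' s • (g s - v)) = (∫ s in c..e, f' s • g s) - (f e - f c) • v := by
    intro c e hac hce heb v
    have hsub : uIcc c e ⊆ Icc a b := by
      rw [uIcc_of_le hce]
      exact Icc_subset_Icc hac heb
    simp_rw [smul_sub]
    rw [intervalIntegral.integral_sub, intervalIntegral.integral_smul_const,
      intervalIntegral.integral_eq_sub_of_hasDerivAt (fun s _ => hf s)
        (hf'.intervalIntegrable _ _)]
    · exact (hf'.continuousOn.smul (hg.mono hsub)).intervalIntegrable
    · exact (hf'.smul continuous_const).intervalIntegrable _ _
  have bound : ∀ c e : ℝ, a ≤ c → c ≤ e → e ≤ b → ∀ v : E, (∀ s ∈ Icc a b, ‖g s - v‖ ≤ η) →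
      ‖∫ s in c..e, f' s • (g s - v)‖ ≤ C * η * (e - c) := by
    intro c e hac hce heb v hv
    refine (intervalIntegral.norm_integral_le_of_norm_le_const (C := C * η) fun s hs => ?_).trans_eq
      (by rw [abs_of_nonneg (sub_nonneg.2 hce)])
    rw [uIoc_of_le hce] at hs
    have hs' : s ∈ Icc a b := ⟨hac.trans hs.1.le, hs.2.trans heb⟩
    rw [norm_smul, Real.norm_eq_abs]
    exact mul_le_mul (hC s hs') (hv s hs') (norm_nonneg _) ((abs_nonneg _).trans (hC s hs'))
  have hI : ∀ c e : ℝ, a ≤ c → c ≤ e → e ≤ b →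
      IntervalIntegrable (fun s => f' s • g s) volume c e := by
    intro c e hac hce heb
    refine (hf'.continuousOn.smul (hg.mono ?_)).intervalIntegrable
    rw [uIcc_of_le hce]
    exact Icc_subset_Icc hac heb
  have heq : f τ • (g b - g a) - (f b • g b - f a • g a - ∫ s in a..b, f' s • g s) =
      (∫ s in a..τ, f' s • (g s - g a)) + ∫ s in τ..b, f' s • (g s - g b) := by
    rw [key a τ le_rfl haτ hτb, key τ b haτ hτb le_rfl,
      ← intervalIntegral.integral_add_adjacent_intervals (hI a τ le_rfl haτ hτb)
        (hI τ b haτ hτb le_rfl)]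
    module
  rw [heq]
  refine (norm_add_le _ _).trans ((add_le_add (bound a τ le_rfl haτ hτb _ hga)
    (bound τ b haτ hτb le_rfl _ hgb)).trans_eq ?_)
  ring

/-- The Riemann-Stieltjes integral `∫_0^t f dg` exists for continuously differentiable `f` and
continuous `g` with values in a Banach space. It is used both for the paths of the noise and for the
noise as a curve in `L²`. -/
theorem tendsto_stieltjes [CompleteSpace E] {f f' : ℝ → ℝ} {g : ℝ → E}
    {t : ℝ} (ht : 0 ≤ t) (hf : ∀ s, HasDerivAt f (f' s) s) (hf' : Continuous f')
    (hg : ContinuousOn g (Icc 0 t)) :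
    Tendsto (fun π : Subdivision 0 t =>
      ∑ k ∈ Finset.range π.n, f (π.τ k) • (g (π.p (k + 1)) - g (π.p k))) (fineMesh 0 t)
      (𝓝 (integralByParts f f' g t)) := by
  rw [(hasBasis_fineMesh 0 t).tendsto_iff Metric.nhds_basis_ball]
  intro ε hε
  obtain ⟨C, hC⟩ := isCompact_Icc.exists_bound_of_continuousOn (s := Icc 0 t) hf'.continuousOn
  have hC0 : 0 ≤ C := (norm_nonneg _).trans (hC 0 ⟨le_rfl, ht⟩)
  set η := ε / (C * t + 1) with hη_def
  have hη : 0 < η := by positivity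
  have hsmall : C * η * t < ε := by
    have h1 : (C * t + 1) * η = ε := by rw [hη_def]; field_simp
    nlinarith
  obtain ⟨δ, hδ, hunif⟩ := Metric.uniformContinuousOn_iff.1
    (isCompact_Icc.uniformContinuousOn_of_continuous hg) η hη
  refine ⟨δ, hδ, fun π hπ => ?_⟩
  rw [mem_ball_iff_norm]
  set Ψ : ℝ → E := fun r => f r • g r - ∫ s in (0 : ℝ)..r, f' s • g s
  have hΨ : integralByParts f f' g t =
      ∑ k ∈ Finset.range π.n, (Ψ (π.p (k + 1)) - Ψ (π.p k)) := by
    rw [Finset.sum_range_sub (fun k => Ψ (π.p k)), π.left, π.right]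
    simp only [Ψ, integralByParts, intervalIntegral.integral_same, sub_zero]
    abel
  have hI : ∀ r ∈ Icc 0 t, IntervalIntegrable (fun s => f' s • g s) volume 0 r := by
    intro r hr
    refine (hf'.continuousOn.smul (hg.mono ?_)).intervalIntegrable
    rw [uIcc_of_le hr.1]
    exact Icc_subset_Icc le_rfl hr.2
  rw [hΨ, ← Finset.sum_sub_distrib]
  have hterm : ∀ k ∈ Finset.range π.n,
      ‖f (π.τ k) • (g (π.p (k + 1)) - g (π.p k)) - (Ψ (π.p (k + 1)) - Ψ (π.p k))‖ ≤
        C * η * (π.p (k + 1) - π.p k) := by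
    intro k hk
    rw [Finset.mem_range] at hk
    have ha := π.p_mem hk.le
    have hb := π.p_mem hk
    have hsub : Icc (π.p k) (π.p (k + 1)) ⊆ Icc 0 t := Icc_subset_Icc ha.1 hb.2
    have hle := (π.tag_mem k hk).1.trans (π.tag_mem k hk).2
    have hΨk : Ψ (π.p (k + 1)) - Ψ (π.p k) = f (π.p (k + 1)) • g (π.p (k + 1)) -
        f (π.p k) • g (π.p k) - ∫ s in π.p k..π.p (k + 1), f' s • g s := by
      rw [← intervalIntegral.integral_interval_sub_left (hI _ hb) (hI _ ha)]
      simp only [Ψ]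
      abel
    rw [hΨk]
    refine norm_stieltjes_term_sub_le (π.tag_mem k hk).1 (π.tag_mem k hk).2 hf hf' (hg.mono hsub)
      (fun s hs => hC s (hsub hs)) ?_ ?_
    · intro s hs
      rw [← dist_eq_norm]
      refine (hunif s (hsub hs) _ ha ?_).le
      rw [Real.dist_eq, abs_of_nonneg (sub_nonneg.2 hs.1)]
      linarith [hπ k hk, hs.2]
    · intro s hs
      rw [← dist_eq_norm]
      refine (hunif s (hsub hs) _ hb ?_).le
      rw [dist_comm, Real.dist_eq, abs_of_nonneg (sub_nonneg.2 hs.2)]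
      linarith [hπ k hk, hs.1]
  refine (norm_sum_le_of_le _ hterm).trans_lt ?_
  rw [← Finset.mul_sum, Finset.sum_range_sub π.p, π.left, π.right, sub_zero]
  exact hsmall

/-- The subdivision of `[0, t]` into `n + 1` equal intervals, tagged by their left ends. -/
def uniformSubdivision {t : ℝ} (ht : 0 ≤ t) (n : ℕ) : Subdivision 0 t where
  n := n + 1
  p k := t * k / (n + 1)
  τ k := t * k / (n + 1)
  left := by simp
  right := by
    push_cast
    field_simp
  tag_mem k _ := by
    refine ⟨le_rfl, ?_⟩
    push_cast
    gcongr
    linarith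

theorem tendsto_uniformSubdivision {t : ℝ} (ht : 0 ≤ t) :
    Tendsto (uniformSubdivision ht) atTop (fineMesh 0 t) := by
  rw [(hasBasis_fineMesh 0 t).tendsto_right_iff]
  intro δ hδ
  have h : Tendsto (fun n : ℕ => t * (1 / ((n : ℝ) + 1))) atTop (𝓝 (t * 0)) :=
    tendsto_one_div_add_atTop_nhds_zero_nat.const_mul t
  rw [mul_zero] at h
  filter_upwards [h.eventually_lt_const hδ] with n hn k _
  refine lt_of_eq_of_lt ?_ hn
  simp only [uniformSubdivision]
  push_cast
  ring

theorem integralByParts_congr {f f' : ℝ → ℝ} {g h : ℝ → E} {t : ℝ} (ht : 0 ≤ t)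
    (hgh : EqOn g h (Icc 0 t)) : integralByParts f f' g t = integralByParts f f' h t := by
  have h1 : ∫ s in (0 : ℝ)..t, f' s • g s = ∫ s in (0 : ℝ)..t, f' s • h s := by
    refine intervalIntegral.integral_congr fun s hs => ?_
    rw [uIcc_of_le ht] at hs
    simp only [hgh hs]
  rw [integralByParts, integralByParts, h1, hgh ⟨ht, le_rfl⟩, hgh ⟨le_rfl, ht⟩]

theorem integralByParts_primitive {f f' h : ℝ → ℝ} (hf : ∀ s, HasDerivAt f (f' s) s)
    (hf' : Continuous f') (hh : Continuous h) (t : ℝ) :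
    integralByParts f f' (fun r => ∫ s in (0 : ℝ)..r, h s) t = ∫ s in (0 : ℝ)..t, f s * h s := by
  have := intervalIntegral.integral_mul_deriv_eq_deriv_mul (a := 0) (b := t)
    (u := f) (v := fun r => ∫ s in (0 : ℝ)..r, h s)
    (fun s _ => hf s) (fun s _ => (hh.integral_hasStrictDerivAt 0 s).hasDerivAt)
    (hf'.intervalIntegrable _ _) (hh.intervalIntegrable _ _)
  rw [this]
  simp [integralByParts]

theorem integralByParts_min {f f' : ℝ → ℝ} (hf : ∀ s, HasDerivAt f (f' s) s)
    (hf' : Continuous f') {r t : ℝ} (hr : 0 ≤ r) (hrt : r ≤ t) :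
    integralByParts f f' (fun s => min r s) t = ∫ s in (0 : ℝ)..r, f s := by
  have hI : ∀ a b : ℝ, IntervalIntegrable (fun s => f' s • min r s) volume a b := fun a b =>
    (hf'.smul (continuous_const.min continuous_id)).intervalIntegrable a b
  have h1 : ∫ s in (0 : ℝ)..r, f' s • min r s = ∫ s in (0 : ℝ)..r, f' s * s := by
    refine intervalIntegral.integral_congr fun s hs => ?_
    rw [uIcc_of_le hr] at hs
    simp [min_eq_right hs.2]
  have h2 : ∫ s in r..t, f' s • min r s = ∫ s in r..t, f' s * r := by
    refine intervalIntegral.integral_congr fun s hs => ?_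
    rw [uIcc_of_le hrt] at hs
    simp [min_eq_left hs.1]
  have h3 := intervalIntegral.integral_mul_deriv_eq_deriv_mul (a := 0) (b := r)
    (u := f) (v := id) (fun s _ => hf s) (fun s _ => hasDerivAt_id s)
    (hf'.intervalIntegrable _ _) (continuous_const.intervalIntegrable _ _)
  simp only [mul_one, id] at h3
  rw [integralByParts, ← intervalIntegral.integral_add_adjacent_intervals (hI 0 r) (hI r t), h1,
    h2, intervalIntegral.integral_mul_const,
    intervalIntegral.integral_eq_sub_of_hasDerivAt (fun s _ => hf s) (hf'.intervalIntegrable _ _),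
    h3, min_eq_left hrt, min_eq_right hr]
  simp only [smul_eq_mul]
  ring

end Stieltjes

/-! ### Integrals against a curve in a Hilbert space with Brownian correlations -/

section Hilbert

variable {H : Type*} [NormedAddCommGroup H] [InnerProductSpace ℝ H] [CompleteSpace H]

theorem inner_integralByParts {f f' : ℝ → ℝ} (hf' : Continuous f') {u : ℝ → H}
    (hu : Continuous u) (y : H) (t : ℝ) :
    inner ℝ y (integralByParts f f' u t) = integralByParts f f' (fun s => inner ℝ y (u s)) t := by
  have h := ContinuousLinearMap.intervalIntegral_comp_comm (innerSL ℝ y)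
    (show IntervalIntegrable (fun s => f' s • u s) volume 0 t from
      (hf'.smul hu).intervalIntegrable _ _)
  simp only [innerSL_apply_apply, inner_smul_right] at h
  simp only [integralByParts, inner_sub_right, inner_smul_right, ← h, smul_eq_mul]

/-- The isometry `⟨∫ f du, ∫ h dv⟩ = c ∫ f h` for curves with `⟨u(s), v(r)⟩ = c min(s, r)`. -/
theorem inner_integralByParts_integralByParts {f f' h h' : ℝ → ℝ}
    (hf : ∀ s, HasDerivAt f (f' s) s) (hf' : Continuous f')
    (hh : ∀ s, HasDerivAt h (h' s) s) (hh' : Continuous h')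
    {u v : ℝ → H} (hu : Continuous u) (hv : Continuous v) {c t : ℝ} (ht : 0 ≤ t)
    (huv : ∀ s ∈ Icc 0 t, ∀ r ∈ Icc 0 t, inner ℝ (u s) (v r) = c * min s r) :
    inner ℝ (integralByParts f f' u t) (integralByParts h h' v t) =
      c * ∫ s in (0 : ℝ)..t, f s * h s := by
  have hscale : ∀ (a a' b : ℝ → ℝ), integralByParts a a' (fun s => c * b s) t =
      c * integralByParts a a' b t := by
    intro a a' b
    simp only [integralByParts, smul_eq_mul, mul_left_comm _ c, intervalIntegral.integral_const_mul]
    ring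
  have hin : EqOn (fun s => inner ℝ (integralByParts h h' v t) (u s))
      (fun s => c * ∫ r in (0 : ℝ)..s, h r) (Icc 0 t) := by
    intro s hs
    simp only
    rw [real_inner_comm, inner_integralByParts hh' hv,
      integralByParts_congr ht (fun r hr => huv s hs r hr), hscale,
      integralByParts_min hh hh' hs.1 hs.2]
  have hhc : Continuous h := continuous_iff_continuousAt.2 fun s => (hh s).continuousAt
  rw [real_inner_comm, inner_integralByParts hf' hu, integralByParts_congr ht hin, hscale,
    integralByParts_primitive hf hf' hhc]

end Hilbert

/-! ### Variation of constants -/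

section Variation

variable {E : Type*} [NormedAddCommGroup E] [NormedSpace ℝ E] [CompleteSpace E] {T : ℝ}

/-- The solution on `[0, T]` of the operator equation `M' = -M A`, `M(0) = 1`. It is a left inverse
of the fundamental solution of `u' = A u`. -/
def adjointSolution (hT : 0 ≤ T) (A : C(Icc (0 : ℝ) T, E →L[ℝ] E)) :
    C(Icc (0 : ℝ) T, E →L[ℝ] E) :=
  (volterraEquiv hT ⟨fun t => -(ContinuousLinearMap.compL ℝ E E E).flip (A t),
    ((ContinuousLinearMap.compL ℝ E E E).flip.continuous.comp A.continuous).neg⟩).symm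
    (ContinuousMap.const _ 1)

/-- The derivative `-M A` of `M`, extended continuously from `[0, T]` to the real line. -/
def inverseTangentDeriv (hT : 0 ≤ T) (A : C(Icc (0 : ℝ) T, E →L[ℝ] E)) (s : ℝ) : E →L[ℝ] E :=
  -(IccExtend hT (adjointSolution hT A) s ∘L IccExtend hT A s)

/-- The solution `M` of `M' = -M A`, `M(0) = 1`, extended from `[0, T]` to a continuously
differentiable function on the real line. -/
def inverseTangent (hT : 0 ≤ T) (A : C(Icc (0 : ℝ) T, E →L[ℝ] E)) (t : ℝ) : E →L[ℝ] E :=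
  1 + ∫ s in (0 : ℝ)..t, inverseTangentDeriv hT A s

variable (hT : 0 ≤ T) (A : C(Icc (0 : ℝ) T, E →L[ℝ] E))

theorem continuous_inverseTangentDeriv : Continuous (inverseTangentDeriv hT A) :=
  ((adjointSolution hT A).continuous.Icc_extend'.clm_comp A.continuous.Icc_extend').neg

theorem hasDerivAt_inverseTangent (t : ℝ) :
    HasDerivAt (inverseTangent hT A) (inverseTangentDeriv hT A t) t :=
  ((continuous_inverseTangentDeriv hT A).integral_hasStrictDerivAt 0 t).hasDerivAt.const_add 1

theorem inverseTangent_zero : inverseTangent hT A 0 = 1 := by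
  simp [inverseTangent]

theorem adjointSolution_apply (t : Icc (0 : ℝ) T) :
    adjointSolution hT A t = inverseTangent hT A t :=
  volterraEquiv_symm_apply hT _ _ t

theorem inverseTangentDeriv_of_mem {s : ℝ} (hs : s ∈ Icc 0 T) :
    inverseTangentDeriv hT A s = -(inverseTangent hT A s ∘L IccExtend hT A s) := by
  rw [inverseTangentDeriv, IccExtend_of_mem hT (adjointSolution hT A) hs, adjointSolution_apply]

/-- Variation of constants: with `u = p + ∫ A u` one has
`(M (u - p))' = -M A (u - p) + M A u = M A p = -M' p`. For constant `p` it shows that `M` inverts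
the fundamental solution; for `p` the path of the noise, it represents the linear response. -/
theorem inverseTangent_apply_volterraEquiv_symm (p : C(Icc (0 : ℝ) T, E)) (t : Icc (0 : ℝ) T) :
    inverseTangent hT A t ((volterraEquiv hT A).symm p t) =
      inverseTangent hT A t (p t) -
        ∫ s in (0 : ℝ)..t, inverseTangentDeriv hT A s (IccExtend hT p s) := by
  set u := (volterraEquiv hT A).symm p
  set ζ : ℝ → E := fun r => ∫ s in (0 : ℝ)..r, IccExtend hT A s (IccExtend hT u s)
  have hu : ∀ s : Icc (0 : ℝ) T, u s = p s + ζ s := volterraEquiv_symm_apply hT A p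
  have hζ : ∀ r, HasDerivAt ζ (IccExtend hT A r (IccExtend hT u r)) r := fun r =>
    ((A.continuous.Icc_extend'.clm_apply u.continuous.Icc_extend').integral_hasStrictDerivAt
      0 r).hasDerivAt
  have hder : ∀ r ∈ uIcc (0 : ℝ) t, HasDerivAt (fun r => inverseTangent hT A r (ζ r))
      (-inverseTangentDeriv hT A r (IccExtend hT p r)) r := by
    intro r hr
    rw [uIcc_of_le t.2.1] at hr
    have hr' : r ∈ Icc 0 T := ⟨hr.1, hr.2.trans t.2.2⟩
    convert (hasDerivAt_inverseTangent hT A r).clm_apply (hζ r) using 1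
    rw [inverseTangentDeriv_of_mem hT A hr', IccExtend_of_mem hT u hr', IccExtend_of_mem hT p hr',
      hu]
    simp
  have hint := intervalIntegral.integral_eq_sub_of_hasDerivAt hder
    (((continuous_inverseTangentDeriv hT A).clm_apply
      p.continuous.Icc_extend').neg.intervalIntegrable _ _)
  rw [intervalIntegral.integral_neg] at hint
  have hζ0 : ζ 0 = 0 := intervalIntegral.integral_same
  rw [hζ0, map_zero, sub_zero] at hint
  rw [hu, map_add, ← hint, sub_eq_add_neg]

theorem inverseTangent_apply_volterraEquiv_symm_const (v : E) (t : Icc (0 : ℝ) T) :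
    inverseTangent hT A t ((volterraEquiv hT A).symm (ContinuousMap.const _ v) t) = v := by
  have h1 : ∀ r, HasDerivAt (fun r => inverseTangent hT A r v) (inverseTangentDeriv hT A r v) r :=
    fun r => by simpa using (hasDerivAt_inverseTangent hT A r).clm_apply (hasDerivAt_const r v)
  have h2 : ∫ s in (0 : ℝ)..t, inverseTangentDeriv hT A s
      (IccExtend hT (ContinuousMap.const _ v) s) = inverseTangent hT A t v - v := by
    have := intervalIntegral.integral_eq_sub_of_hasDerivAt (a := 0) (b := t) (fun r _ => h1 r)
      (((continuous_inverseTangentDeriv hT A).clm_apply continuous_const).intervalIntegrable _ _)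
    rw [inverseTangent_zero] at this
    exact this
  rw [inverseTangent_apply_volterraEquiv_symm, h2]
  simp

end Variation

/-! ### The flow and its tangent map -/

section Flow

variable {d : ℕ} {Φ : Space d → ℝ → Space d} {T : ℝ} {x : Space d}
  {S : ℝ → Space d → Space d}

theorem IsSolution.continuousOn {y : Space d} {γ : ℝ → Space d} (h : IsSolution Φ T y γ) :
    ContinuousOn γ (Icc 0 T) := fun t ht => (h.2 t ht).continuousWithinAt

/-- A path that is continuous on `[0, T]`, as a bundled map. -/
def pathOn {γ : ℝ → Space d} (h : ContinuousOn γ (Icc 0 T)) : C(Icc (0 : ℝ) T, Space d) :=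
  ⟨fun t => γ t, continuousOn_iff_continuous_domRestrict.1 h⟩

theorem IsSolution.defect_pathOn (hΦ : IsC1VectorField Φ) (hT : 0 ≤ T) {y : Space d}
    {γ : ℝ → Space d} (h : IsSolution Φ T y γ) :
    defect hΦ hT (pathOn h.continuousOn) = ContinuousMap.const _ y := by
  rw [defect_apply_eq_iff hΦ hT (γ' := γ) fun _ => rfl]
  intro t
  have hsub : Icc (0 : ℝ) t ⊆ Icc 0 T := Icc_subset_Icc le_rfl t.2.2
  have hc : ContinuousOn (fun s => Φ (γ s) s) (Icc 0 t) :=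
    hΦ.continuous.comp_continuousOn ((h.continuousOn.mono hsub).prodMk continuousOn_id)
  have := intervalIntegral.integral_eq_sub_of_hasDerivAt_of_le t.2.1 (h.continuousOn.mono hsub)
    (fun s hs => (h.2 s (hsub (Ioo_subset_Icc_self hs))).hasDerivAt
      (Icc_mem_nhds hs.1 (hs.2.trans_le t.2.2)))
    (by
      refine ContinuousOn.intervalIntegrable ?_
      rwa [uIcc_of_le t.2.1])
  rw [this, h.1]
  simp

/-- The reference path `t ↦ S_t(x)`. -/
def referencePath (hS : IsForwardFlowNear Φ T x S) : C(Icc (0 : ℝ) T, Space d) :=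
  pathOn hS.self_of_nhds.continuousOn

theorem defect_referencePath (hΦ : IsC1VectorField Φ) (hT : 0 ≤ T)
    (hS : IsForwardFlowNear Φ T x S) :
    defect hΦ hT (referencePath hS) = ContinuousMap.const _ x :=
  hS.self_of_nhds.defect_pathOn hΦ hT

/-- The constant paths, as a linear function of their value. -/
def constPath (d : ℕ) (T : ℝ) : Space d →L[ℝ] C(Icc (0 : ℝ) T, Space d) :=
  LinearMap.mkContinuous
    { toFun := fun v => ContinuousMap.const _ v
      map_add' := fun _ _ => rfl
      map_smul' := fun _ _ => rfl }
    1 (fun v => by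
      rw [one_mul, ContinuousMap.norm_le _ (norm_nonneg v)]
      exact fun _ => le_rfl)

/-- The solution `u = p + ∫_0^t DΦ(S_s(x), s) u(s) ds` of the equation linearized along `S_t(x)`. -/
def response (hΦ : IsC1VectorField Φ) (hT : 0 ≤ T) (hS : IsForwardFlowNear Φ T x S) :
    C(Icc (0 : ℝ) T, Space d) ≃L[ℝ] C(Icc (0 : ℝ) T, Space d) :=
  (volterraEquiv hT (derivAlong hΦ (referencePath hS))).symm

theorem hasFDerivAt_flow (hΦ : IsC1VectorField Φ) (hT : 0 ≤ T) (hS : IsForwardFlowNear Φ T x S)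
    (t : Icc (0 : ℝ) T) :
    HasFDerivAt (S t) (ContinuousMap.evalCLM ℝ t ∘L
      (response hΦ hT hS : C(Icc (0 : ℝ) T, Space d) →L[ℝ] C(Icc (0 : ℝ) T, Space d)) ∘L
        constPath d T) x := by
  set φ := referencePath hS
  have hφ : defect hΦ hT φ = constPath d T x := defect_referencePath hΦ hT hS
  have hevol := hasFDerivAt_evolution hΦ hT φ
  have hright := eventually_defect_evolution hΦ hT φ
  rw [hφ] at hevol hright
  have hcomp := ((ContinuousMap.evalCLM ℝ t).hasFDerivAt.comp x
    (hevol.comp x (constPath d T).hasFDerivAt))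
  refine hcomp.congr_of_eventuallyEq ?_
  filter_upwards [hS, (constPath d T).continuous.continuousAt.eventually hright] with y hy hy'
  have : evolution hΦ hT φ (constPath d T y) = pathOn hy.continuousOn :=
    defect_injective hΦ hT (hy'.trans (hy.defect_pathOn hΦ hT).symm)
  change S t y = evolution hΦ hT φ (constPath d T y) t
  rw [this]
  rfl

/-- The matrix of a linear operator of `ℝ^d` in the standard basis. -/
def operatorMatrix (A : Space d →L[ℝ] Space d) : Matrix (Fin d) (Fin d) ℝ :=
  Matrix.of fun i j => A (EuclideanSpace.single j 1) i

theorem toEuclideanLin_operatorMatrix (A : Space d →L[ℝ] Space d) (v : Space d) :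
    (operatorMatrix A).toEuclideanLin v = A v := by
  have hv : v = ∑ j, v j • EuclideanSpace.single j (1 : ℝ) := by
    simpa using ((EuclideanSpace.basisFun (Fin d) ℝ).sum_repr v).symm
  ext i
  conv_rhs => rw [hv]
  simp [operatorMatrix, Matrix.toLpLin_apply, Matrix.mulVec, dotProduct, mul_comm]

theorem operatorMatrix_mul_operatorMatrix {A B : Space d →L[ℝ] Space d} (h : ∀ v, A (B v) = v) :
    operatorMatrix A * operatorMatrix B = 1 := by
  ext i j
  have h1 : (operatorMatrix A * operatorMatrix B) i j =
      (operatorMatrix A).toEuclideanLin (B (EuclideanSpace.single j 1)) i := by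
    simp [operatorMatrix, Matrix.toLpLin_apply, Matrix.mulVec, dotProduct, Matrix.mul_apply]
  rw [h1, toEuclideanLin_operatorMatrix, h, Matrix.one_apply]
  simp

theorem tangentMap_eq_operatorMatrix (hΦ : IsC1VectorField Φ) (hT : 0 ≤ T)
    (hS : IsForwardFlowNear Φ T x S) (t : Icc (0 : ℝ) T) :
    tangentMap S x t = operatorMatrix (ContinuousMap.evalCLM ℝ t ∘L
      (response hΦ hT hS : C(Icc (0 : ℝ) T, Space d) →L[ℝ] C(Icc (0 : ℝ) T, Space d)) ∘L
        constPath d T) := by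
  rw [← (hasFDerivAt_flow hΦ hT hS t).fderiv]
  rfl

/-- The inverse tangent map `L⁻¹(x, t)`, extended from `[0, T]` to the real line. -/
def inverseMatrix (hΦ : IsC1VectorField Φ) (hT : 0 ≤ T) (hS : IsForwardFlowNear Φ T x S) (t : ℝ) :
    Matrix (Fin d) (Fin d) ℝ :=
  operatorMatrix (inverseTangent hT (derivAlong hΦ (referencePath hS)) t)

/-- The derivative of `L⁻¹(x, t)`. -/
def inverseMatrixDeriv (hΦ : IsC1VectorField Φ) (hT : 0 ≤ T) (hS : IsForwardFlowNear Φ T x S)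
    (t : ℝ) : Matrix (Fin d) (Fin d) ℝ :=
  operatorMatrix (inverseTangentDeriv hT (derivAlong hΦ (referencePath hS)) t)

theorem hasDerivAt_inverseMatrix (hΦ : IsC1VectorField Φ) (hT : 0 ≤ T)
    (hS : IsForwardFlowNear Φ T x S) (i j : Fin d) (t : ℝ) :
    HasDerivAt (fun t => inverseMatrix hΦ hT hS t i j) (inverseMatrixDeriv hΦ hT hS t i j) t := by
  have h := (hasDerivAt_inverseTangent hT (derivAlong hΦ (referencePath hS)) t).clm_apply
    (hasDerivAt_const t (EuclideanSpace.single j (1 : ℝ)))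
  rw [map_zero, add_zero] at h
  exact (EuclideanSpace.proj (𝕜 := ℝ) i).hasFDerivAt.comp_hasDerivAt t h

theorem continuous_inverseMatrixDeriv (hΦ : IsC1VectorField Φ) (hT : 0 ≤ T)
    (hS : IsForwardFlowNear Φ T x S) (i j : Fin d) :
    Continuous fun t => inverseMatrixDeriv hΦ hT hS t i j :=
  (EuclideanSpace.proj (𝕜 := ℝ) i).continuous.comp
    ((continuous_inverseTangentDeriv hT _).clm_apply continuous_const)

theorem continuous_inverseMatrix (hΦ : IsC1VectorField Φ) (hT : 0 ≤ T)
    (hS : IsForwardFlowNear Φ T x S) (i j : Fin d) :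
    Continuous fun t => inverseMatrix hΦ hT hS t i j :=
  continuous_iff_continuousAt.2 fun t => (hasDerivAt_inverseMatrix hΦ hT hS i j t).continuousAt

theorem inverseMatrix_mul_tangentMap (hΦ : IsC1VectorField Φ) (hT : 0 ≤ T)
    (hS : IsForwardFlowNear Φ T x S) {t : ℝ} (ht : t ∈ Icc 0 T) :
    inverseMatrix hΦ hT hS t * tangentMap S x t = 1 := by
  rw [tangentMap_eq_operatorMatrix hΦ hT hS ⟨t, ht⟩]
  exact operatorMatrix_mul_operatorMatrix fun v =>
    inverseTangent_apply_volterraEquiv_symm_const hT _ v ⟨t, ht⟩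

theorem tangentMap_inv (hΦ : IsC1VectorField Φ) (hT : 0 ≤ T)
    (hS : IsForwardFlowNear Φ T x S) {t : ℝ} (ht : t ∈ Icc 0 T) :
    (tangentMap S x t)⁻¹ = inverseMatrix hΦ hT hS t :=
  Matrix.inv_eq_left_inv (inverseMatrix_mul_tangentMap hΦ hT hS ht)

theorem isUnit_det_tangentMap (hΦ : IsC1VectorField Φ) (hT : 0 ≤ T)
    (hS : IsForwardFlowNear Φ T x S) {t : ℝ} (ht : t ∈ Icc 0 T) :
    IsUnit (tangentMap S x t).det :=
  Matrix.isUnit_det_of_left_inverse (inverseMatrix_mul_tangentMap hΦ hT hS ht)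

theorem inv_transpose_mul_tangentMap (hΦ : IsC1VectorField Φ) (hT : 0 ≤ T)
    (hS : IsForwardFlowNear Φ T x S) {t : ℝ} (ht : t ∈ Icc 0 T) :
    ((tangentMap S x t)ᵀ * tangentMap S x t)⁻¹ =
      inverseMatrix hΦ hT hS t * (inverseMatrix hΦ hT hS t)ᵀ := by
  rw [Matrix.mul_inv_rev, ← Matrix.transpose_nonsing_inv, tangentMap_inv hΦ hT hS ht]

/-- The value that partial integration assigns to `∫_0^t F dg`, for a matrix function `F` with
derivative `F'` and a path `g` in `ℝ^d`. -/
def vectorIntegralByParts (F F' : ℝ → Matrix (Fin d) (Fin d) ℝ) (g : ℝ → Space d) (t : ℝ) :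
    Space d :=
  WithLp.toLp 2 fun i => ∑ j, integralByParts (F · i j) (F' · i j) (fun s => g s j) t

theorem response_eq_toEuclideanLin (hΦ : IsC1VectorField Φ) (hT : 0 ≤ T)
    (hS : IsForwardFlowNear Φ T x S) {g : ℝ → Space d} (hg : ContinuousOn g (Icc 0 T))
    (hg0 : g 0 = 0) {t : ℝ} (ht : t ∈ Icc 0 T) :
    response hΦ hT hS (pathOn hg) ⟨t, ht⟩ = (tangentMap S x t).toEuclideanLin
      (vectorIntegralByParts (inverseMatrix hΦ hT hS) (inverseMatrixDeriv hΦ hT hS) g t) := by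
  set A := derivAlong hΦ (referencePath hS)
  set r := response hΦ hT hS (pathOn hg) ⟨t, ht⟩ with hr
  have hvar := inverseTangent_apply_volterraEquiv_symm hT A (pathOn hg) ⟨t, ht⟩
  have hcongr : ∫ s in (0 : ℝ)..t, inverseTangentDeriv hT A s (IccExtend hT (pathOn hg) s) =
      ∫ s in (0 : ℝ)..t, inverseTangentDeriv hT A s (g s) := by
    refine intervalIntegral.integral_congr fun s hs => ?_
    rw [uIcc_of_le ht.1] at hs
    simp only [IccExtend_of_mem hT (pathOn hg) ⟨hs.1, hs.2.trans ht.2⟩]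
    rfl
  have hgt : ContinuousOn g (Icc 0 t) := hg.mono (Icc_subset_Icc le_rfl ht.2)
  have hvec : vectorIntegralByParts (inverseMatrix hΦ hT hS) (inverseMatrixDeriv hΦ hT hS) g t =
      inverseTangent hT A t (g t) - ∫ s in (0 : ℝ)..t, inverseTangentDeriv hT A s (g s) := by
    have hentry : ∀ (B : Space d →L[ℝ] Space d) (v : Space d) (i : Fin d),
        B v i = ∑ j, operatorMatrix B i j * v j := by
      intro B v i
      rw [← toEuclideanLin_operatorMatrix]
      simp [Matrix.toLpLin_apply, Matrix.mulVec, dotProduct]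
    ext i
    have hint : (∫ s in (0 : ℝ)..t, inverseTangentDeriv hT A s (g s)) i =
        ∑ j, ∫ s in (0 : ℝ)..t, inverseMatrixDeriv hΦ hT hS s i j * g s j := by
      have hI : IntervalIntegrable (fun s => inverseTangentDeriv hT A s (g s)) volume 0 t := by
        refine ContinuousOn.intervalIntegrable ?_
        rw [uIcc_of_le ht.1]
        exact (continuous_inverseTangentDeriv hT A).continuousOn.clm_apply hgt
      have hproj : ∫ s in (0 : ℝ)..t, inverseTangentDeriv hT A s (g s) i =
          (∫ s in (0 : ℝ)..t, inverseTangentDeriv hT A s (g s)) i :=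
        ContinuousLinearMap.intervalIntegral_comp_comm (EuclideanSpace.proj (𝕜 := ℝ) i) hI
      simp_rw [← hproj, hentry]
      rw [intervalIntegral.integral_finsetSum]
      · rfl
      · intro j _
        refine ContinuousOn.intervalIntegrable ?_
        rw [uIcc_of_le ht.1]
        exact (continuous_inverseMatrixDeriv hΦ hT hS i j).continuousOn.mul
          ((EuclideanSpace.proj (𝕜 := ℝ) j).continuous.comp_continuousOn hgt)
    rw [PiLp.sub_apply, hint, hentry, ← Finset.sum_sub_distrib]
    change (∑ j : Fin d, integralByParts _ _ _ t) = _
    refine Finset.sum_congr rfl fun j _ => ?_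
    simp [integralByParts, hg0, inverseMatrix, A]
  have hMr : inverseTangent hT A t r =
      vectorIntegralByParts (inverseMatrix hΦ hT hS) (inverseMatrixDeriv hΦ hT hS) g t := by
    rw [hvec, ← hcongr]
    exact hvar
  have hLM : tangentMap S x t * inverseMatrix hΦ hT hS t = 1 :=
    mul_eq_one_comm.1 (inverseMatrix_mul_tangentMap hΦ hT hS ht)
  rw [← hMr, ← toEuclideanLin_operatorMatrix (inverseTangent hT A t)]
  change r = (tangentMap S x t).toEuclideanLin ((inverseMatrix hΦ hT hS t).toEuclideanLin r)
  rw [Matrix.toLpLin_apply, Matrix.toLpLin_apply]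
  simp [Matrix.mulVec_mulVec, hLM]

end Flow

/-! ### Evolution along a noisy path -/

section Noisy

variable {d : ℕ} {Φ : Space d → ℝ → Space d} {T : ℝ} {x : Space d}
  {S : ℝ → Space d → Space d}

/-- The evolution of `x` with noise `ε g`, for small `ε`. For large `ε`, when a solution on `[0, T]`
need not exist, the value carries no meaning. -/
def noisyPath (hΦ : IsC1VectorField Φ) (hT : 0 ≤ T) (hS : IsForwardFlowNear Φ T x S)
    (g : C(Icc (0 : ℝ) T, Space d)) (ε : ℝ) : C(Icc (0 : ℝ) T, Space d) :=
  evolution hΦ hT (referencePath hS) (ContinuousMap.const _ x + ε • g)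

theorem const_add_zero_smul (g : C(Icc (0 : ℝ) T, Space d)) :
    ContinuousMap.const (Icc (0 : ℝ) T) x + (0 : ℝ) • g = ContinuousMap.const _ x := by
  ext1 t
  simp

theorem eventually_defect_noisyPath (hΦ : IsC1VectorField Φ) (hT : 0 ≤ T)
    (hS : IsForwardFlowNear Φ T x S) (g : C(Icc (0 : ℝ) T, Space d)) :
    ∀ᶠ ε in 𝓝 (0 : ℝ),
      defect hΦ hT (noisyPath hΦ hT hS g ε) = ContinuousMap.const _ x + ε • g := by
  have h := eventually_defect_evolution hΦ hT (referencePath hS)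
  rw [defect_referencePath] at h
  have hc : Tendsto (fun ε : ℝ => ContinuousMap.const (Icc (0 : ℝ) T) x + ε • g) (𝓝 0)
      (𝓝 (ContinuousMap.const _ x)) := by
    have : Continuous fun ε : ℝ => ContinuousMap.const (Icc (0 : ℝ) T) x + ε • g := by fun_prop
    have h0 := this.tendsto 0
    rwa [const_add_zero_smul] at h0
  exact hc.eventually h

theorem isNoisySolution_iff (hΦ : IsC1VectorField Φ) (hT : 0 ≤ T) {g γ : ℝ → Space d}
    (hg : ContinuousOn g (Icc 0 T)) {ε : ℝ} :
    IsNoisySolution Φ T x g ε γ ↔ ∃ hγ : ContinuousOn γ (Icc 0 T),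
      defect hΦ hT (pathOn hγ) = ContinuousMap.const _ x + ε • pathOn hg := by
  have hiff : ∀ hγ : ContinuousOn γ (Icc 0 T), (∀ t ∈ Icc 0 T,
      γ t = x + (∫ s in (0 : ℝ)..t, Φ (γ s) s) + ε • g t) ↔
      defect hΦ hT (pathOn hγ) = ContinuousMap.const _ x + ε • pathOn hg := by
    intro hγ
    rw [defect_apply_eq_iff hΦ hT (γ' := γ) fun _ => rfl, Subtype.forall]
    refine forall₂_congr fun t ht => ?_
    change _ ↔ γ t = x + ε • g t + _
    rw [add_right_comm]
  constructor
  · rintro ⟨hγ, h⟩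
    exact ⟨hγ, (hiff hγ).1 h⟩
  · rintro ⟨hγ, h⟩
    exact ⟨hγ, (hiff hγ).2 h⟩

theorem eventually_isNoisySolution_noisyPath (hΦ : IsC1VectorField Φ) (hT : 0 ≤ T)
    (hS : IsForwardFlowNear Φ T x S) {g : ℝ → Space d} (hg : ContinuousOn g (Icc 0 T)) :
    ∀ᶠ ε in 𝓝 (0 : ℝ), IsNoisySolution Φ T x g ε
      (IccExtend hT (noisyPath hΦ hT hS (pathOn hg) ε)) := by
  filter_upwards [eventually_defect_noisyPath hΦ hT hS (pathOn hg)] with ε hε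
  refine (isNoisySolution_iff hΦ hT hg).2
    ⟨(ContinuousMap.continuous _).Icc_extend'.continuousOn, ?_⟩
  rw [← hε]
  congr 1
  ext1 t
  exact IccExtend_val hT _ t

theorem eventually_eq_noisyPath (hΦ : IsC1VectorField Φ) (hT : 0 ≤ T)
    (hS : IsForwardFlowNear Φ T x S) {g : ℝ → Space d} (hg : ContinuousOn g (Icc 0 T))
    {y : ℝ → ℝ → Space d}
    (hy : ∀ᶠ ε in 𝓝[≠] (0 : ℝ), IsNoisySolution Φ T x g ε (y ε)) :
    ∀ᶠ ε in 𝓝[≠] (0 : ℝ), ∀ t : Icc (0 : ℝ) T,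
      y ε t = noisyPath hΦ hT hS (pathOn hg) ε t := by
  filter_upwards [hy, (eventually_defect_noisyPath hΦ hT hS (pathOn hg)).filter_mono
    nhdsWithin_le_nhds] with ε hε hε' t
  obtain ⟨hγ, h⟩ := (isNoisySolution_iff hΦ hT hg).1 hε
  exact DFunLike.congr_fun (defect_injective hΦ hT (h.trans hε'.symm)) t

theorem tendsto_noisyPath (hΦ : IsC1VectorField Φ) (hT : 0 ≤ T)
    (hS : IsForwardFlowNear Φ T x S) (g : C(Icc (0 : ℝ) T, Space d)) :
    Tendsto (fun ε : ℝ => ε⁻¹ • (noisyPath hΦ hT hS g ε - referencePath hS)) (𝓝[≠] 0)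
      (𝓝 (response hΦ hT hS g)) := by
  have hevol := hasFDerivAt_evolution hΦ hT (referencePath hS)
  have hline : HasDerivAt (fun ε : ℝ => ContinuousMap.const (Icc (0 : ℝ) T) x + ε • g) g 0 := by
    simpa using ((hasDerivAt_id (0 : ℝ)).smul_const g).const_add
      (ContinuousMap.const (Icc (0 : ℝ) T) x)
  have h0 : ContinuousMap.const (Icc (0 : ℝ) T) x + (0 : ℝ) • g =
      defect hΦ hT (referencePath hS) := by
    rw [defect_referencePath, const_add_zero_smul]
  rw [← h0] at hevol
  have h := (hevol.comp_hasDerivAt (0 : ℝ) hline).tendsto_slope_zero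
  have h1 : noisyPath hΦ hT hS g 0 = referencePath hS := by
    rw [noisyPath, h0, evolution_defect]
  simp only [zero_add, Function.comp_apply] at h
  rw [← h1]
  exact h

theorem tendsto_of_eventually_isNoisySolution (hΦ : IsC1VectorField Φ) (hT : 0 ≤ T)
    (hS : IsForwardFlowNear Φ T x S) {g : ℝ → Space d} (hg : ContinuousOn g (Icc 0 T))
    {y : ℝ → ℝ → Space d}
    (hy : ∀ᶠ ε in 𝓝[≠] (0 : ℝ), IsNoisySolution Φ T x g ε (y ε)) (t : Icc (0 : ℝ) T) :
    Tendsto (fun ε : ℝ => ε⁻¹ • (y ε t - S t x)) (𝓝[≠] 0)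
      (𝓝 (response hΦ hT hS (pathOn hg) t)) := by
  have h := ((ContinuousMap.evalCLM ℝ t).continuous.tendsto _).comp
    (tendsto_noisyPath hΦ hT hS (pathOn hg))
  refine h.congr' ?_
  filter_upwards [eventually_eq_noisyPath hΦ hT hS hg hy] with ε hε
  rw [hε]
  rfl

theorem eq_response_iff (hΦ : IsC1VectorField Φ) (hT : 0 ≤ T)
    (hS : IsForwardFlowNear Φ T x S) {g Ξ : ℝ → Space d} (hg : ContinuousOn g (Icc 0 T)) :
    (∀ t : Icc (0 : ℝ) T, Ξ t = response hΦ hT hS (pathOn hg) t) ↔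
      ContinuousOn Ξ (Icc 0 T) ∧ ∀ t ∈ Icc 0 T,
        Ξ t = (∫ s in (0 : ℝ)..t, spatialDeriv Φ (S s x) s (Ξ s)) + g t := by
  set A := derivAlong hΦ (referencePath hS)
  have hiff : ∀ hΞ : ContinuousOn Ξ (Icc 0 T), (∀ t ∈ Icc 0 T,
      Ξ t = (∫ s in (0 : ℝ)..t, spatialDeriv Φ (S s x) s (Ξ s)) + g t) ↔
      pathOn hΞ = response hΦ hT hS (pathOn hg) := by
    intro hΞ
    rw [response, ContinuousLinearEquiv.eq_symm_apply, ContinuousMap.ext_iff, Subtype.forall]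
    refine forall₂_congr fun t ht => ?_
    rw [volterraEquiv_apply]
    have hcongr : ∫ s in (0 : ℝ)..t, IccExtend hT A s (IccExtend hT (pathOn hΞ) s) =
        ∫ s in (0 : ℝ)..t, spatialDeriv Φ (S s x) s (Ξ s) := by
      refine intervalIntegral.integral_congr fun s hs => ?_
      rw [uIcc_of_le ht.1] at hs
      have hs' : s ∈ Icc 0 T := ⟨hs.1, hs.2.trans ht.2⟩
      simp only [IccExtend_of_mem hT _ hs']
      rfl
    rw [hcongr, sub_eq_iff_eq_add, add_comm]
    rfl
  constructor
  · intro h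
    have hΞ : ContinuousOn Ξ (Icc 0 T) := by
      rw [continuousOn_iff_continuous_domRestrict]
      exact (response hΦ hT hS (pathOn hg)).continuous.congr fun t => (h t).symm
    exact ⟨hΞ, (hiff hΞ).2 (ContinuousMap.ext h)⟩
  · rintro ⟨hΞ, h⟩ t
    exact DFunLike.congr_fun ((hiff hΞ).1 h) t

end Noisy

/-! ### The Wiener integral -/

section Noise

variable {d : ℕ} {Ω : Type*} [MeasurableSpace Ω] {P : Measure Ω} {T : ℝ} {w : ℝ → Ω → Space d}

/-- A coordinate of the noise as a curve in `L²`, extended from `[0, T]` to the real line by its end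
values. -/
def noiseCurve (hT : 0 ≤ T) (hw : IsIntegratedWhiteNoise P T w) (j : Fin d) (t : ℝ) : Lp ℝ 2 P :=
  ((hw.memLp (projIcc 0 T hT t) (projIcc 0 T hT t).2).eval_piLp j).toLp _

theorem coeFn_noiseCurve (hT : 0 ≤ T) (hw : IsIntegratedWhiteNoise P T w) (j : Fin d) {t : ℝ}
    (ht : t ∈ Icc 0 T) : noiseCurve hT hw j t =ᵐ[P] fun ω => w t ω j := by
  have h := MemLp.coeFn_toLp ((hw.memLp (projIcc 0 T hT t) (projIcc 0 T hT t).2).eval_piLp j)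
  rw [noiseCurve]
  filter_upwards [h] with ω hω
  rw [hω, projIcc_of_mem hT ht]

theorem inner_eq_integral_of_ae_eq {f g : Lp ℝ 2 P} {f' g' : Ω → ℝ} (hf : f =ᵐ[P] f')
    (hg : g =ᵐ[P] g') : inner ℝ f g = ∫ ω, f' ω * g' ω ∂P := by
  rw [L2.inner_def]
  refine integral_congr_ae ?_
  filter_upwards [hf, hg] with ω h1 h2
  rw [h1, h2, RCLike.inner_apply, conj_trivial, mul_comm]

theorem inner_noiseCurve (hT : 0 ≤ T) (hw : IsIntegratedWhiteNoise P T w) (i j : Fin d) {s t : ℝ}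
    (hs : s ∈ Icc 0 T) (ht : t ∈ Icc 0 T) :
    inner ℝ (noiseCurve hT hw i s) (noiseCurve hT hw j t) = if i = j then min s t else 0 := by
  rw [inner_eq_integral_of_ae_eq (coeFn_noiseCurve hT hw i hs) (coeFn_noiseCurve hT hw j ht),
    hw.correlation s hs t ht]

theorem continuous_noiseCurve (hT : 0 ≤ T) (hw : IsIntegratedWhiteNoise P T w) (j : Fin d) :
    Continuous (noiseCurve hT hw j) := by
  have hproj : ∀ t, noiseCurve hT hw j t = noiseCurve hT hw j (projIcc 0 T hT t) := fun t => by
    simp only [noiseCurve, projIcc_val]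
  -- the increments satisfy `‖w(s) - w(t)‖² = s - 2 min(s, t) + t = |s - t|`
  have hnorm : ∀ s t, ‖noiseCurve hT hw j s - noiseCurve hT hw j t‖ =
      √|(projIcc 0 T hT s : ℝ) - projIcc 0 T hT t| := by
    intro s t
    rw [eq_comm, Real.sqrt_eq_iff_mul_self_eq (abs_nonneg _) (norm_nonneg _),
      ← real_inner_self_eq_norm_mul_norm, hproj s, hproj t, real_inner_sub_sub_self]
    have hs := (projIcc 0 T hT s).2
    have ht := (projIcc 0 T hT t).2
    rw [inner_noiseCurve hT hw j j hs hs, inner_noiseCurve hT hw j j hs ht,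
      inner_noiseCurve hT hw j j ht ht]
    simp only [if_true, min_self]
    rcases le_total (projIcc 0 T hT s : ℝ) (projIcc 0 T hT t) with h | h
    · rw [min_eq_left h, abs_of_nonpos (sub_nonpos.2 h)]
      ring
    · rw [min_eq_right h, abs_of_nonneg (sub_nonneg.2 h)]
      ring
  rw [continuous_iff_continuousAt]
  intro t
  rw [ContinuousAt, tendsto_iff_norm_sub_tendsto_zero]
  simp_rw [hnorm]
  have hc : Continuous fun s => √|(projIcc 0 T hT s : ℝ) - projIcc 0 T hT t| :=
    ((continuous_subtype_val.comp continuous_projIcc).sub continuous_const).abs.sqrt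
  simpa using hc.tendsto t

theorem coeFn_stieltjes_noiseCurve (hT : 0 ≤ T) (hw : IsIntegratedWhiteNoise P T w) (j : Fin d)
    (f : ℝ → ℝ) {t : ℝ} (ht : t ∈ Icc 0 T) (π : Subdivision 0 t) :
    ((∑ k ∈ Finset.range π.n, f (π.τ k) •
      (noiseCurve hT hw j (π.p (k + 1)) - noiseCurve hT hw j (π.p k)) : Lp ℝ 2 P) : Ω → ℝ) =ᵐ[P]
      fun ω => ∑ k ∈ Finset.range π.n, f (π.τ k) • (w (π.p (k + 1)) ω j - w (π.p k) ω j) := by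
  have hmem : ∀ k ≤ π.n, π.p k ∈ Icc 0 T := fun k hk =>
    Icc_subset_Icc le_rfl ht.2 (π.p_mem hk)
  have hterm : ∀ k ∈ Finset.range π.n, ∀ᵐ ω ∂P,
      (f (π.τ k) • (noiseCurve hT hw j (π.p (k + 1)) - noiseCurve hT hw j (π.p k)) : Lp ℝ 2 P) ω =
        f (π.τ k) • (w (π.p (k + 1)) ω j - w (π.p k) ω j) := by
    intro k hk
    rw [Finset.mem_range] at hk
    filter_upwards [Lp.coeFn_smul (f (π.τ k))
      (noiseCurve hT hw j (π.p (k + 1)) - noiseCurve hT hw j (π.p k)),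
      Lp.coeFn_sub (noiseCurve hT hw j (π.p (k + 1))) (noiseCurve hT hw j (π.p k)),
      coeFn_noiseCurve hT hw j (hmem (k + 1) hk), coeFn_noiseCurve hT hw j (hmem k hk.le)]
      with ω h1 h2 h3 h4
    rw [h1, Pi.smul_apply, h2, Pi.sub_apply, h3, h4]
  filter_upwards [Lp.coeFn_finsetSum (Finset.range π.n) fun k => f (π.τ k) •
      (noiseCurve hT hw j (π.p (k + 1)) - noiseCurve hT hw j (π.p k)),
    (Finset.eventually_all _).2 hterm] with ω h1 h2
  rw [h1, Finset.sum_apply]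
  exact Finset.sum_congr rfl h2

theorem continuousOn_coord {g : ℝ → Space d} {s : Set ℝ} (hg : ContinuousOn g s) (j : Fin d) :
    ContinuousOn (fun t => g t j) s :=
  (EuclideanSpace.proj (𝕜 := ℝ) j).continuous.comp_continuousOn hg

/-- The integral of the curve in `L²` is represented by the pathwise integrals: both are limits in
probability of the same Riemann-Stieltjes sums. -/
theorem coeFn_integralByParts_noiseCurve [IsFiniteMeasure P] (hT : 0 ≤ T)
    (hw : IsIntegratedWhiteNoise P T w) (j : Fin d) {f f' : ℝ → ℝ}
    (hf : ∀ s, HasDerivAt f (f' s) s) (hf' : Continuous f') {t : ℝ} (ht : t ∈ Icc 0 T) :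
    ((integralByParts f f' (noiseCurve hT hw j) t : Lp ℝ 2 P) : Ω → ℝ) =ᵐ[P]
      fun ω => integralByParts f f' (fun s => w s ω j) t := by
  have hmesh := tendsto_uniformSubdivision ht.1
  have hL2 := (tendsto_stieltjes ht.1 hf hf'
    (continuous_noiseCurve hT hw j).continuousOn).comp hmesh
  have hsums := fun n => coeFn_stieltjes_noiseCurve hT hw j f ht (uniformSubdivision ht.1 n)
  refine tendstoInMeasure_ae_unique (tendstoInMeasure_of_tendsto_Lp hL2)
    (tendstoInMeasure_of_tendsto_ae (fun n => Lp.aestronglyMeasurable _) ?_)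
  filter_upwards [hw.continuousOn, ae_all_iff.2 hsums] with ω hω h
  have hpath := (tendsto_stieltjes ht.1 hf hf' (continuousOn_coord
    (hω.mono (Icc_subset_Icc le_rfl ht.2)) j)).comp hmesh
  exact hpath.congr fun n => (h n).symm

theorem stieltjesSum_apply (F : ℝ → Matrix (Fin d) (Fin d) ℝ) (g : ℝ → Space d) {a b : ℝ}
    (π : Subdivision a b) (i : Fin d) :
    stieltjesSum F g π i = ∑ j, ∑ k ∈ Finset.range π.n,
      F (π.τ k) i j • (g (π.p (k + 1)) j - g (π.p k) j) := by
  rw [Finset.sum_comm]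
  simp [stieltjesSum, Matrix.toLpLin_apply, Matrix.mulVec, dotProduct]

theorem stieltjesSum_congr {F G : ℝ → Matrix (Fin d) (Fin d) ℝ} {a b : ℝ}
    (h : EqOn F G (Icc a b)) (g : ℝ → Space d) (π : Subdivision a b) :
    stieltjesSum F g π = stieltjesSum G g π :=
  Finset.sum_congr rfl fun k hk => by rw [h (π.τ_mem (Finset.mem_range.1 hk))]

theorem hasStieltjesIntegral_vectorIntegralByParts {F F' : ℝ → Matrix (Fin d) (Fin d) ℝ}
    (hF : ∀ i j s, HasDerivAt (F · i j) (F' s i j) s) (hF' : ∀ i j, Continuous (F' · i j))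
    {g : ℝ → Space d} {t : ℝ} (ht : 0 ≤ t) (hg : ContinuousOn g (Icc 0 t)) :
    HasStieltjesIntegral F g 0 t (vectorIntegralByParts F F' g t) := by
  rw [hasStieltjesIntegral_iff_tendsto]
  refine ((PiLp.continuous_toLp 2 fun _ : Fin d => ℝ).tendsto _).comp
    (tendsto_pi_nhds.2 fun i => ?_) |>.congr fun π => WithLp.toLp_ofLp 2 (stieltjesSum F g π)
  simp_rw [stieltjesSum_apply]
  exact tendsto_finsetSum _ fun j _ =>
    tendsto_stieltjes ht (hF i j) (hF' i j) (continuousOn_coord hg j)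

/-- A coordinate of `∫_0^t F dw` in `L²`. -/
def wienerCoord (hT : 0 ≤ T) (hw : IsIntegratedWhiteNoise P T w)
    (F F' : ℝ → Matrix (Fin d) (Fin d) ℝ) (t : ℝ) (i : Fin d) : Lp ℝ 2 P :=
  ∑ j, integralByParts (F · i j) (F' · i j) (noiseCurve hT hw j) t

variable {F F' : ℝ → Matrix (Fin d) (Fin d) ℝ}

theorem coeFn_wienerCoord [IsFiniteMeasure P] (hT : 0 ≤ T) (hw : IsIntegratedWhiteNoise P T w)
    (hF : ∀ i j s, HasDerivAt (F · i j) (F' s i j) s) (hF' : ∀ i j, Continuous (F' · i j))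
    {t : ℝ} (ht : t ∈ Icc 0 T) (i : Fin d) :
    (wienerCoord hT hw F F' t i : Ω → ℝ) =ᵐ[P]
      fun ω => vectorIntegralByParts F F' (fun s => w s ω) t i := by
  filter_upwards [Lp.coeFn_finsetSum Finset.univ
      fun j => integralByParts (F · i j) (F' · i j) (noiseCurve hT hw j) t,
    ae_all_iff.2 fun j => coeFn_integralByParts_noiseCurve hT hw j (hF i j) (hF' i j) ht]
    with ω h1 h2
  rw [wienerCoord, h1, Finset.sum_apply]
  exact Finset.sum_congr rfl fun j _ => h2 j

theorem memLp_vectorIntegralByParts [IsFiniteMeasure P] (hT : 0 ≤ T)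
    (hw : IsIntegratedWhiteNoise P T w)
    (hF : ∀ i j s, HasDerivAt (F · i j) (F' s i j) s) (hF' : ∀ i j, Continuous (F' · i j))
    {t : ℝ} (ht : t ∈ Icc 0 T) :
    MemLp (fun ω => vectorIntegralByParts F F' (fun s => w s ω) t) 2 P :=
  MemLp.of_eval_piLp fun i =>
    (memLp_congr_ae (coeFn_wienerCoord hT hw hF hF' ht i)).1 (Lp.memLp _)

theorem norm_le_sum_norm_coord (v : Space d) : ‖v‖ ≤ ∑ i, ‖v i‖ := by
  have hv : v = ∑ i, v i • EuclideanSpace.single i (1 : ℝ) := by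
    simpa using ((EuclideanSpace.basisFun (Fin d) ℝ).sum_repr v).symm
  conv_lhs => rw [hv]
  refine norm_sum_le_of_le _ fun i _ => ?_
  rw [norm_smul, PiLp.norm_single, norm_one, mul_one]

theorem isWienerIntegral_vectorIntegralByParts [IsFiniteMeasure P] (hT : 0 ≤ T)
    (hw : IsIntegratedWhiteNoise P T w)
    (hF : ∀ i j s, HasDerivAt (F · i j) (F' s i j) s) (hF' : ∀ i j, Continuous (F' · i j))
    {t : ℝ} (ht : t ∈ Icc 0 T) :
    IsWienerIntegral P F w 0 t fun ω => vectorIntegralByParts F F' (fun s => w s ω) t := by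
  refine ⟨memLp_vectorIntegralByParts hT hw hF hF' ht, ?_⟩
  -- the error of the sum over `π`, one coordinate at a time, as an element of `L²`
  set e : Fin d → Subdivision 0 t → Lp ℝ 2 P := fun i π =>
    (∑ j, ∑ k ∈ Finset.range π.n, F (π.τ k) i j •
      (noiseCurve hT hw j (π.p (k + 1)) - noiseCurve hT hw j (π.p k))) - wienerCoord hT hw F F' t i
    with he
  have hlim : ∀ i, Tendsto (e i) (fineMesh 0 t) (𝓝 0) := by
    intro i
    have hj : ∀ j, Tendsto (fun π : Subdivision 0 t => ∑ k ∈ Finset.range π.n, F (π.τ k) i j •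
        (noiseCurve hT hw j (π.p (k + 1)) - noiseCurve hT hw j (π.p k))) (fineMesh 0 t)
        (𝓝 (integralByParts (F · i j) (F' · i j) (noiseCurve hT hw j) t)) := fun j =>
      tendsto_stieltjes (f := fun s => F s i j) (g := noiseCurve hT hw j) ht.1 (hF i j) (hF' i j)
        (continuous_noiseCurve hT hw j).continuousOn
    have hsub := (tendsto_finsetSum Finset.univ fun j _ => hj j).sub_const
      (wienerCoord hT hw F F' t i)
    rwa [← wienerCoord, sub_self] at hsub
  have hsum : Tendsto (fun π => ∑ i, ‖e i π‖) (fineMesh 0 t) (𝓝 0) := by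
    have := tendsto_finsetSum Finset.univ fun i (_ : i ∈ Finset.univ) => (hlim i).norm
    simpa using this
  have hcoord : ∀ i π, (e i π : Ω → ℝ) =ᵐ[P] fun ω => (stieltjesSum F (fun s => w s ω) π -
      vectorIntegralByParts F F' (fun s => w s ω) t) i := by
    intro i π
    filter_upwards [Lp.coeFn_sub (∑ j, ∑ k ∈ Finset.range π.n, F (π.τ k) i j •
        (noiseCurve hT hw j (π.p (k + 1)) - noiseCurve hT hw j (π.p k)))
        (wienerCoord hT hw F F' t i),
      Lp.coeFn_finsetSum Finset.univ fun j => ∑ k ∈ Finset.range π.n, F (π.τ k) i j •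
        (noiseCurve hT hw j (π.p (k + 1)) - noiseCurve hT hw j (π.p k)),
      ae_all_iff.2 fun j => coeFn_stieltjes_noiseCurve hT hw j (F · i j) ht π,
      coeFn_wienerCoord hT hw hF hF' ht i] with ω h1 h2 h3 h4
    rw [he, h1, Pi.sub_apply, h2, Finset.sum_apply, h4, PiLp.sub_apply, stieltjesSum_apply]
    simp only [h3]
  have hbound : ∀ π : Subdivision 0 t, eLpNorm (fun ω => stieltjesSum F (fun s => w s ω) π -
      vectorIntegralByParts F F' (fun s => w s ω) t) 2 P ≤ ENNReal.ofReal (∑ i, ‖e i π‖) := by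
    intro π
    calc _ ≤ eLpNorm (∑ i, fun ω => ‖e i π ω‖) 2 P := by
          refine eLpNorm_mono_ae_real ?_
          filter_upwards [ae_all_iff.2 fun i => hcoord i π] with ω hω
          rw [Finset.sum_apply]
          simp only [hω]
          exact norm_le_sum_norm_coord _
      _ ≤ ∑ i, eLpNorm (fun ω => ‖e i π ω‖) 2 P :=
          eLpNorm_sum_le (fun i _ => (Lp.aestronglyMeasurable (e i π)).norm) one_le_two
      _ = ENNReal.ofReal (∑ i, ‖e i π‖) := by
          rw [ENNReal.ofReal_sum_of_nonneg fun i _ => norm_nonneg _]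
          refine Finset.sum_congr rfl fun i _ => ?_
          rw [eLpNorm_norm, Lp.norm_def, ENNReal.ofReal_toReal (Lp.eLpNorm_ne_top _)]
  intro ε hε
  obtain ⟨δ, hδ, h⟩ := (hasBasis_fineMesh 0 t).eventually_iff.1 (hsum.eventually_lt_const hε)
  exact ⟨δ, hδ, fun π hπ => (hbound π).trans_lt ((ENNReal.ofReal_lt_ofReal_iff hε).2 (h hπ))⟩

theorem inner_wienerCoord (hT : 0 ≤ T) (hw : IsIntegratedWhiteNoise P T w)
    (hF : ∀ i j s, HasDerivAt (F · i j) (F' s i j) s) (hF' : ∀ i j, Continuous (F' · i j))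
    {t : ℝ} (ht : t ∈ Icc 0 T) (a b : Fin d) :
    inner ℝ (wienerCoord hT hw F F' t a) (wienerCoord hT hw F F' t b) =
      matrixIntegral (fun s => F s * (F s)ᵀ) 0 t a b := by
  have hFc : ∀ i j, Continuous (F · i j) := fun i j =>
    continuous_iff_continuousAt.2 fun s => (hF i j s).continuousAt
  have hij : ∀ j l, inner ℝ (integralByParts (F · a j) (F' · a j) (noiseCurve hT hw j) t)
      (integralByParts (F · b l) (F' · b l) (noiseCurve hT hw l) t) =
        (if j = l then 1 else 0) * ∫ s in (0 : ℝ)..t, F s a j * F s b l := by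
    intro j l
    refine inner_integralByParts_integralByParts (hF a j) (hF' a j) (hF b l) (hF' b l)
      (continuous_noiseCurve hT hw j) (continuous_noiseCurve hT hw l) ht.1 fun s hs r hr => ?_
    rw [inner_noiseCurve hT hw j l ⟨hs.1, hs.2.trans ht.2⟩ ⟨hr.1, hr.2.trans ht.2⟩]
    simp
  simp only [wienerCoord, sum_inner, inner_sum, hij, ite_mul, one_mul, zero_mul,
    Finset.sum_ite_eq', Finset.mem_univ, if_true, matrixIntegral,
    Matrix.of_apply, Matrix.mul_apply, Matrix.transpose_apply]
  rw [intervalIntegral.integral_finsetSum]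
  exact fun j _ => ((hFc a j).mul (hFc b j)).intervalIntegrable _ _

theorem integral_wienerCoord [IsFiniteMeasure P] (hT : 0 ≤ T) (hw : IsIntegratedWhiteNoise P T w)
    (hF' : ∀ i j, Continuous (F' · i j)) {t : ℝ} (ht : t ∈ Icc 0 T) (i : Fin d) :
    ∫ ω, wienerCoord hT hw F F' t i ω ∂P = 0 := by
  have hone : ∀ f : Lp ℝ 2 P, inner ℝ (indicatorConstLp 2 MeasurableSet.univ
      (measure_ne_top P univ) (1 : ℝ)) f = ∫ ω, f ω ∂P := fun f => by
    rw [L2.inner_indicatorConstLp_one, setIntegral_univ]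
  rw [← hone, wienerCoord, inner_sum]
  refine Finset.sum_eq_zero fun j _ => ?_
  have hzero : EqOn (fun s => inner ℝ (indicatorConstLp 2 MeasurableSet.univ
      (measure_ne_top P univ) (1 : ℝ)) (noiseCurve hT hw j s)) (fun _ => 0) (Icc 0 t) := by
    intro s hs
    have hs' : s ∈ Icc 0 T := ⟨hs.1, hs.2.trans ht.2⟩
    simp only
    rw [hone, integral_congr_ae (coeFn_noiseCurve hT hw j hs'),
      ← eval_integral_piLp fun i => ((hw.memLp s hs').eval_piLp i).integrable one_le_two,
      hw.mean s hs']
    rfl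
  rw [inner_integralByParts (hF' i j) (continuous_noiseCurve hT hw j),
    integralByParts_congr ht.1 hzero]
  simp [integralByParts]

theorem integral_vectorIntegralByParts [IsFiniteMeasure P] (hT : 0 ≤ T)
    (hw : IsIntegratedWhiteNoise P T w)
    (hF : ∀ i j s, HasDerivAt (F · i j) (F' s i j) s) (hF' : ∀ i j, Continuous (F' · i j))
    {t : ℝ} (ht : t ∈ Icc 0 T) :
    ∫ ω, vectorIntegralByParts F F' (fun s => w s ω) t ∂P = 0 := by
  ext i
  rw [eval_integral_piLp fun i => ((memLp_vectorIntegralByParts hT hw hF hF' ht).eval_piLp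
    i).integrable one_le_two, ← integral_congr_ae (coeFn_wienerCoord hT hw hF hF' ht i),
    integral_wienerCoord hT hw hF' ht]
  rfl

theorem covarianceMatrix_vectorIntegralByParts [IsProbabilityMeasure P] (hT : 0 ≤ T)
    (hw : IsIntegratedWhiteNoise P T w)
    (hF : ∀ i j s, HasDerivAt (F · i j) (F' s i j) s) (hF' : ∀ i j, Continuous (F' · i j))
    {t : ℝ} (ht : t ∈ Icc 0 T) :
    covarianceMatrix P (fun ω => vectorIntegralByParts F F' (fun s => w s ω) t) =
      matrixIntegral (fun s => F s * (F s)ᵀ) 0 t := by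
  ext a b
  have hmem := (memLp_vectorIntegralByParts hT hw hF hF' ht).eval_piLp
  have hco := coeFn_wienerCoord hT hw hF hF' ht
  rw [covarianceMatrix, Matrix.of_apply, covariance_eq_sub (hmem a) (hmem b),
    ← integral_congr_ae (hco a), integral_wienerCoord hT hw hF' ht, zero_mul, sub_zero,
    ← inner_wienerCoord hT hw hF hF' ht, inner_eq_integral_of_ae_eq (hco a) (hco b)]
  rfl

theorem covarianceMatrix_toEuclideanLin [IsFiniteMeasure P] (L : Matrix (Fin d) (Fin d) ℝ)
    {Z : Ω → Space d} (hZ : MemLp Z 2 P) :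
    covarianceMatrix P (fun ω => L.toEuclideanLin (Z ω)) = L * covarianceMatrix P Z * Lᵀ := by
  ext i k
  have hLZ : ∀ ω i, L.toEuclideanLin (Z ω) i = ∑ a, L i a * Z ω a := fun ω i => by
    simp [Matrix.toLpLin_apply, Matrix.mulVec, dotProduct]
  simp only [covarianceMatrix, Matrix.of_apply, hLZ, Matrix.mul_apply, Matrix.transpose_apply]
  rw [covariance_fun_sum_fun_sum (fun a => (hZ.eval_piLp a).const_mul _)
    (fun b => (hZ.eval_piLp b).const_mul _)]
  simp only [covariance_const_mul_left, covariance_const_mul_right, Finset.sum_mul]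
  rw [Finset.sum_comm]
  refine Finset.sum_congr rfl fun b _ => Finset.sum_congr rfl fun a _ => ?_
  ring

theorem covarianceMatrix_congr {X Y : Ω → Space d} (h : X =ᵐ[P] Y) :
    covarianceMatrix P X = covarianceMatrix P Y := by
  ext i j
  have hmean : ∀ k, ∫ ω, X ω k ∂P = ∫ ω, Y ω k ∂P := fun k =>
    integral_congr_ae (h.fun_comp fun v => v k)
  simp only [covarianceMatrix, Matrix.of_apply, covariance, hmean]
  refine integral_congr_ae ?_
  filter_upwards [h] with ω hω
  rw [hω]

end Noise

end ForwardNoise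

end

theorem mainTheorem4 {d : ℕ} {Ω : Type*} [MeasurableSpace Ω] (P : Measure Ω)
    [IsProbabilityMeasure P]
    (Φ : Space d → ℝ → Space d) (hΦ : IsC1VectorField Φ)
    (T : ℝ) (hT : 0 ≤ T) (x : Space d)
    (S : ℝ → Space d → Space d) (hS : IsForwardFlowNear Φ T x S)
    (w : ℝ → Ω → Space d) (hw : IsIntegratedWhiteNoise P T w) :
    -- the tangent map exists, is invertible, and the integrand of the covariance is integrable
    (∀ t ∈ Icc 0 T, DifferentiableAt ℝ (S t) x ∧ IsUnit (tangentMap S x t).det ∧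
      ∀ i j, IntervalIntegrable (fun s => ((tangentMap S x s)ᵀ * tangentMap S x s)⁻¹ i j)
        volume 0 t) ∧
    -- the noisy evolution exists
    (∃ y, IsNoisyEvolution P Φ T x w y) ∧
    ∀ y, IsNoisyEvolution P Φ T x w y →
      -- the linear response exists and is characterized by the linear equation
      (∃ Ξ, IsLinearResponse P S T x y Ξ) ∧
      (∀ Ξ, IsLinearResponse P S T x y Ξ ↔ SolvesLinearEquation P Φ S T x w Ξ) ∧
      ∀ Ξ, IsLinearResponse P S T x y Ξ →
        -- `Ξ(t) = L(t) ∫_0^t L⁻¹(t') dw(t')`, pathwise and in mean square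
        (∃ Z : ℝ → Ω → Space d,
          (∀ t ∈ Icc 0 T, IsWienerIntegral P (fun s => (tangentMap S x s)⁻¹) w 0 t (Z t)) ∧
          ∀ᵐ ω ∂P, ∀ t ∈ Icc 0 T,
            HasStieltjesIntegral (fun s => (tangentMap S x s)⁻¹) (fun s => w s ω) 0 t (Z t ω) ∧
            Ξ t ω = (tangentMap S x t).toEuclideanLin (Z t ω)) ∧
        -- mean, covariance matrix and forward error
        ∀ t ∈ Icc 0 T,
          MemLp (Ξ t) 2 P ∧ ∫ ω, Ξ t ω ∂P = 0 ∧
          covarianceMatrix P (Ξ t) = forwardMatrix (tangentMap S x) t ∧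
          forwardError P (Ξ t) = Real.sqrt (forwardMatrix (tangentMap S x) t).trace := by
  classical
  set M := inverseMatrix hΦ hT hS
  set M' := inverseMatrixDeriv hΦ hT hS
  have hM := hasDerivAt_inverseMatrix hΦ hT hS
  have hM' := continuous_inverseMatrixDeriv hΦ hT hS
  have hinv : ∀ t ∈ Icc 0 T, EqOn (fun s => (tangentMap S x s)⁻¹) M (Icc 0 t) :=
    fun t ht s hs => tangentMap_inv hΦ hT hS ⟨hs.1, hs.2.trans ht.2⟩
  have hgram : ∀ t ∈ Icc 0 T, ∀ s ∈ Icc 0 t,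
      ((tangentMap S x s)ᵀ * tangentMap S x s)⁻¹ = M s * (M s)ᵀ :=
    fun t ht s hs => inv_transpose_mul_tangentMap hΦ hT hS ⟨hs.1, hs.2.trans ht.2⟩
  refine ⟨fun t ht => ⟨(hasFDerivAt_flow hΦ hT hS ⟨t, ht⟩).differentiableAt,
    isUnit_det_tangentMap hΦ hT hS ht, fun i j => ?_⟩, ?_, fun y hy => ?_⟩
  · have hc : Continuous fun s => (M s * (M s)ᵀ) i j := by
      simp only [Matrix.mul_apply, Matrix.transpose_apply]
      exact continuous_finsetSum _ fun k _ => (continuous_inverseMatrix hΦ hT hS i k).mul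
        (continuous_inverseMatrix hΦ hT hS j k)
    refine ContinuousOn.intervalIntegrable ?_
    rw [uIcc_of_le ht.1]
    exact hc.continuousOn.congr fun s hs => by rw [hgram t ht s hs]
  · refine ⟨fun ε t ω => if h : ContinuousOn (fun t => w t ω) (Icc 0 T) then
      IccExtend hT (noisyPath hΦ hT hS (pathOn h) ε) t else 0, ?_⟩
    filter_upwards [hw.continuousOn] with ω hω
    simp only [dif_pos hω]
    exact (eventually_isNoisySolution_noisyPath hΦ hT hS hω).filter_mono nhdsWithin_le_nhds
  -- almost surely, the linear response is the path `response w`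
  have hresp : ∀ᵐ ω ∂P, ∃ hω : ContinuousOn (fun t => w t ω) (Icc 0 T), w 0 ω = 0 ∧
      ∀ t : Icc (0 : ℝ) T, Tendsto (fun ε : ℝ => ε⁻¹ • (y ε t ω - S t x)) (𝓝[≠] 0)
        (𝓝 (response hΦ hT hS (pathOn hω) t)) := by
    filter_upwards [hw.continuousOn, hw.zero, hy] with ω hω h0 hyω
    exact ⟨hω, h0, tendsto_of_eventually_isNoisySolution (y := fun ε t => y ε t ω) hΦ hT hS hω hyω⟩
  refine ⟨⟨fun t ω => limUnder (𝓝[≠] 0) fun ε : ℝ => ε⁻¹ • (y ε t ω - S t x), ?_⟩,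
    fun Ξ => eventually_congr ?_, fun Ξ hΞ => ?_⟩
  · filter_upwards [hresp] with ω ⟨hω, _, h⟩ t ht
    exact tendsto_nhds_limUnder ⟨_, h ⟨t, ht⟩⟩
  · filter_upwards [hresp] with ω ⟨hω, _, h⟩
    rw [← eq_response_iff hΦ hT hS hω, Subtype.forall]
    refine forall₂_congr fun t ht => ⟨fun h' => tendsto_nhds_unique h' (h ⟨t, ht⟩), fun h' => ?_⟩
    rw [h']
    exact h ⟨t, ht⟩
  set Z : ℝ → Ω → Space d := fun t ω => vectorIntegralByParts M M' (fun s => w s ω) t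
  have hΞZ : ∀ᵐ ω ∂P, ∀ t ∈ Icc 0 T, Ξ t ω = (tangentMap S x t).toEuclideanLin (Z t ω) := by
    filter_upwards [hresp, hΞ] with ω ⟨hω, h0, h⟩ hΞω t ht
    rw [tendsto_nhds_unique (hΞω t ht) (h ⟨t, ht⟩)]
    exact response_eq_toEuclideanLin hΦ hT hS hω h0 ht
  refine ⟨⟨Z, fun t ht => ?_, ?_⟩, fun t ht => ?_⟩
  · have h := isWienerIntegral_vectorIntegralByParts hT hw hM hM' ht
    simp only [IsWienerIntegral, stieltjesSum_congr (hinv t ht)] at h ⊢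
    exact h
  · filter_upwards [hΞZ, hw.continuousOn] with ω h hω t ht
    refine ⟨?_, h t ht⟩
    have h := hasStieltjesIntegral_vectorIntegralByParts hM hM' ht.1
      (hω.mono (Icc_subset_Icc le_rfl ht.2))
    simp only [HasStieltjesIntegral, stieltjesSum_congr (hinv t ht)] at h ⊢
    exact h
  · have hae : Ξ t =ᵐ[P] fun ω => (tangentMap S x t).toEuclideanLin (Z t ω) := by
      filter_upwards [hΞZ] with ω h using h t ht
    have hZ : MemLp (Z t) 2 P := memLp_vectorIntegralByParts hT hw hM hM' ht
    have hcov : covarianceMatrix P (Ξ t) = forwardMatrix (tangentMap S x) t := by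
      rw [covarianceMatrix_congr hae, covarianceMatrix_toEuclideanLin _ hZ,
        covarianceMatrix_vectorIntegralByParts hT hw hM hM' ht, forwardMatrix]
      congr 2
      ext i j
      refine intervalIntegral.integral_congr fun s hs => ?_
      rw [uIcc_of_le ht.1] at hs
      simp only [hgram t ht s hs]
      rfl
    refine ⟨?_, ?_, hcov, by rw [forwardError, hcov]⟩
    · exact (memLp_congr_ae hae).2
        ((tangentMap S x t).toEuclideanLin.toContinuousLinearMap.comp_memLp' hZ)
    · rw [integral_congr_ae hae]
      have := (tangentMap S x t).toEuclideanLin.toContinuousLinearMap.integral_comp_comm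
        (hZ.integrable one_le_two)
      refine this.trans ?_
      rw [integral_vectorIntegralByParts hT hw hM hM' ht, map_zero]
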